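/- Let $\mathcal P$ be a family of probability measures on a measurable space $(\Omega,\mathcal A)$, let $T:\mathcal P\to\mathbb R$, and fix $P\in\mathcal P$. A path in $\mathcal P$ with tangent $g$ at $P$, where $g\in L_2(P)$ and $\int g\,dP=0$, is a family $(Q_s)$ of probability measures with $Q_s\in\mathcal P$ for all small $s>0$ and $\sqrt{dQ_s}=(1+\tfrac s2 g)\sqrt{dP}+o(s)$ in $L_2$ as $s\downarrow0$. The tangent set $\mathcal G\subset L_2(P)$ consists of all $g$ for which such a path exists; for each $g\in\mathcal G$ fix one such path $(P_{g,s})$, and put $P_{n,g,t}=P_{g,t/\sqrt n}$. Assume that $\mathcal G$ is closed, and that $T$ is differentiable at $P$: for some $\kappa\in L_2(P)$, $T(P_{g,s})=T(P)+s\langle\kappa,g\rangle+o(s)$ as $s\downarrow0$, for every $g\in\mathcal G$. An estimator sequence $S=(S_n)$ consists of measurable functions $S_n:\Omega^n\to\mathbb R$; $P^n$ is the law of $n$ i.i.d. observations $x_1,\dots,x_n$ from $P$, $o_{P^n}(1)$ denotes convergence to $0$ in $P^n$-probability, $u_+=\max(u,0)$, $\Phi$ is the standard normal distribution function and $\|\cdot\|$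 the norm of $L_2(P)$. For $g\in\mathcal G$ consider the conditions $$(1)_g\quad \limsup_{n\to\infty}P^n_{n,g,t}\{S_n<T(P_{n,g,t})\}\le\tfrac12\ \ \forall t>0,\qquad (2)_g\quad \limsup_{n\to\infty}P^n_{n,g,t}\{S_n>T(P_{n,g,t})\}\le\tfrac12\ \ \forall t>0.$$ a) Suppose that $\mathcal G$ is a convex cone with vertex $0$, and that the projection (best approximation) $\hat\kappa$ of $\kappa$ onto $\mathcal G$ is not $0$. If $S$ satisfies $(1)_{\hat\kappa}$, then for all $c>0$ $$\limsup_{n\to\infty}P^n\{T(P)>S_n-c/\sqrt n\}\le\Phi(c/\|\hat\kappa\|).$$ An estimator sequence $\hat S$ satisfies $(1)_{\hat\kappa}$ and attains the bound for all $c>0$, in the sense that $P^n\{T(P)>\hat S_n-c/\sqrt n\}\to\Phi(c/\|\hat\kappa\|)$ for all $c>0$, if and only if $$\sqrt n\,(\hat S_n-T(P))_+=\Bigl(n^{-1/2}\sum_{i=1}^n\hat\kappa(x_i)\Bigr)_++o_{P^n}(1).$$ b) Suppose that $\mathcal G$ is a linear space, and that the orthogonal projection $\bar\kappa$ of $\kappa$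 onto $\mathcal G$ is not $0$. If $S$ satisfies $(1)_{\bar\kappa}$ and $(2)_{-\bar\kappa}$, then for all $c',c''>0$ $$\limsup_{n\to\infty}P^n\{S_n-c''/\sqrt n<T(P)<S_n+c'/\sqrt n\}\le\Phi(c''/\|\bar\kappa\|)-\Phi(-c'/\|\bar\kappa\|).$$ An estimator sequence $\bar S$ satisfies $(1)_{\bar\kappa}$ and $(2)_{-\bar\kappa}$ and attains the bound for all $c',c''>0$, in the sense that $P^n\{\bar S_n-c''/\sqrt n<T(P)<\bar S_n+c'/\sqrt n\}\to\Phi(c''/\|\bar\kappa\|)-\Phi(-c'/\|\bar\kappa\|)$ for all $c',c''>0$, if and only if $$\sqrt n\,(\bar S_n-T(P))=n^{-1/2}\sum_{i=1}^n\bar\kappa(x_i)+o_{P^n}(1).$$ -/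

import Mathlib

open MeasureTheory ProbabilityTheory Filter Topology Asymptotics

noncomputable section

namespace TangentConeInference

variable {Ω : Type*} [MeasurableSpace Ω]

/-- The law `P^n` of `n` i.i.d. observations from `P`, on `Ω^n`. -/
def iidLaw (P : ProbabilityMeasure Ω) (n : ℕ) : Measure (Fin n → Ω) :=
  Measure.pi fun _ => (P : Measure Ω)

/-- The `L₂`-size of `√dQ - (1 + (s/2) g) √dP`. Both measures are represented by their densities
with respect to `P + Q`; the value is the same for every dominating measure. -/
def rootRemainder (P Q : ProbabilityMeasure Ω) (g : Ω → ℝ) (s : ℝ) : ENNReal :=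
  eLpNorm
    (fun x =>
      √(((Q : Measure Ω).rnDeriv ((P : Measure Ω) + (Q : Measure Ω)) x).toReal) -
        (1 + s / 2 * g x) *
          √(((P : Measure Ω).rnDeriv ((P : Measure Ω) + (Q : Measure Ω)) x).toReal))
    2 ((P : Measure Ω) + (Q : Measure Ω))

/-- `s ↦ Q s` is a path in the family `𝓜` with tangent `g` at `P`: `g ∈ L₂(P)`, `g ⊥ 1`,
`Q s ∈ 𝓜` for all small `s > 0`, and `√dQ_s = (1 + (s/2) g) √dP + o(s)` in `L₂` as `s ↓ 0`. -/
structure IsTangentPath (𝓜 : Set (ProbabilityMeasure Ω)) (P : ProbabilityMeasure Ω)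
    (g : Lp ℝ 2 (P : Measure Ω)) (Q : ℝ → ProbabilityMeasure Ω) : Prop where
  centered : ∫ x, g x ∂(P : Measure Ω) = 0
  mem : ∀ᶠ s in 𝓝[>] (0 : ℝ), Q s ∈ 𝓜
  root_diff : Tendsto (fun s => rootRemainder P (Q s) g s / ENNReal.ofReal s) (𝓝[>] 0) (𝓝 0)

/-- The tangent set of `𝓜` at `P`. -/
def tangentSet (𝓜 : Set (ProbabilityMeasure Ω)) (P : ProbabilityMeasure Ω) :
    Set (Lp ℝ 2 (P : Measure Ω)) :=
  {g | ∃ Q : ℝ → ProbabilityMeasure Ω, IsTangentPath 𝓜 P g Q}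

/-- The functional `T` is differentiable at `P` along the paths `path g`, with gradient `κ`:
`T (P_{g,s}) = T P + s ⟨κ, g⟩ + o(s)` as `s ↓ 0`, for every tangent `g`. -/
def HasGradient (𝓜 : Set (ProbabilityMeasure Ω)) (P : ProbabilityMeasure Ω)
    (path : Lp ℝ 2 (P : Measure Ω) → ℝ → ProbabilityMeasure Ω)
    (T : ProbabilityMeasure Ω → ℝ) (κ : Lp ℝ 2 (P : Measure Ω)) : Prop :=
  ∀ g ∈ tangentSet 𝓜 P,
    (fun s : ℝ => T (path g s) - T P - s * inner ℝ κ g) =o[𝓝[>] 0] (fun s : ℝ => s)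

/-- A convex cone with vertex at `0`. -/
def IsConvexCone {H : Type*} [AddCommGroup H] [Module ℝ H] (G : Set H) : Prop :=
  (0 : H) ∈ G ∧
    ∀ g₁ ∈ G, ∀ g₂ ∈ G, ∀ γ₁ γ₂ : ℝ, 0 ≤ γ₁ → 0 ≤ γ₂ → γ₁ • g₁ + γ₂ • g₂ ∈ G

/-- A linear subspace. -/
def IsLinearSpace {H : Type*} [AddCommGroup H] [Module ℝ H] (G : Set H) : Prop :=
  ∃ V : Submodule ℝ H, (V : Set H) = G

/-- `p` is the projection (best approximation) of `κ` onto `G`; for a closed linear space this is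
the orthogonal projection. -/
def IsProjection {H : Type*} [NormedAddCommGroup H] (G : Set H) (κ p : H) : Prop :=
  p ∈ G ∧ ∀ g ∈ G, ‖κ - p‖ ≤ ‖κ - g‖

/-- Under the local alternatives `Q (t/√n)`, the median of `S n` is asymptotically at least `T`:
`limsup_n Q_{t/√n}^n {S_n < T(Q_{t/√n})} ≤ 1/2` for all `t > 0`. -/
def AsympMedianGE (T : ProbabilityMeasure Ω → ℝ) (Q : ℝ → ProbabilityMeasure Ω)
    (S : (n : ℕ) → (Fin n → Ω) → ℝ) : Prop :=
  ∀ t : ℝ, 0 < t →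
    limsup (fun n : ℕ => (iidLaw (Q (t / √(n : ℝ))) n).real {x | S n x < T (Q (t / √(n : ℝ)))})
      atTop ≤ 1 / 2

/-- Under the local alternatives `Q (t/√n)`, the median of `S n` is asymptotically at most `T`:
`limsup_n Q_{t/√n}^n {S_n > T(Q_{t/√n})} ≤ 1/2` for all `t > 0`. -/
def AsympMedianLE (T : ProbabilityMeasure Ω → ℝ) (Q : ℝ → ProbabilityMeasure Ω)
    (S : (n : ℕ) → (Fin n → Ω) → ℝ) : Prop :=
  ∀ t : ℝ, 0 < t →
    limsup (fun n : ℕ => (iidLaw (Q (t / √(n : ℝ))) n).real {x | S n x > T (Q (t / √(n : ℝ)))})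
      atTop ≤ 1 / 2

/-- `R n → 0` in `P^n`-probability. -/
def IsLittleOProb (P : ProbabilityMeasure Ω) (R : (n : ℕ) → (Fin n → Ω) → ℝ) : Prop :=
  ∀ ε : ℝ, 0 < ε → Tendsto (fun n : ℕ => (iidLaw P n).real {x | ε ≤ |R n x|}) atTop (𝓝 0)

/-- `n^{-1/2} ∑_{i=1}^n η(x_i)`. -/
def normedSum (η : Ω → ℝ) (n : ℕ) (x : Fin n → Ω) : ℝ :=
  (√(n : ℝ))⁻¹ * ∑ i, η (x i)

/-- The standard normal distribution function. -/
def Phi (u : ℝ) : ℝ := cdf (gaussianReal 0 1) u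

/-- `P^n {T(P) > S_n - c/√n}`. -/
def oneSidedProb (P : ProbabilityMeasure Ω) (T : ProbabilityMeasure Ω → ℝ)
    (S : (n : ℕ) → (Fin n → Ω) → ℝ) (c : ℝ) (n : ℕ) : ℝ :=
  (iidLaw P n).real {x | T P > S n x - c / √(n : ℝ)}

/-- `P^n {S_n - c''/√n < T(P) < S_n + c'/√n}`. -/
def twoSidedProb (P : ProbabilityMeasure Ω) (T : ProbabilityMeasure Ω → ℝ)
    (S : (n : ℕ) → (Fin n → Ω) → ℝ) (c' c'' : ℝ) (n : ℕ) : ℝ :=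
  (iidLaw P n).real {x | S n x - c'' / √(n : ℝ) < T P ∧ T P < S n x + c' / √(n : ℝ)}

end TangentConeInference

end

/-! Only one direction matters, namely the projection `g` of `κ`. Since `G` contains all nonnegative
multiples of `g`, minimality of the distance along this ray gives `⟨κ, g⟩ = ‖g‖²`
(`IsProjection.inner_eq`). So along the path with tangent `g` the functional moves by `t‖g‖²/√n`,
while the normed sum of `g` is asymptotically `N(t‖g‖², ‖g‖²)`. The problem becomes that of a
Gaussian shift with variance `v = ‖g‖²` and unknown mean `tv`.

The reduction is a form of local asymptotic normality (`IsTangentPath.tendsto_iidLaw_sub`). The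
alternatives are replaced by exponential tilts of `P` in the direction of `g`, truncated at
`n^{1/4}` and recentred. The `n`-fold product of a tilt is exactly `exp(t X_n - t²v/2)`, where `X_n`
is the truncated score. A Hellinger estimate for product measures shows that the two laws give the
same limiting probabilities to every sequence of events. The central limit theorem gives the limit
law of `X_n`, and bounded tilts give convergence of its moment generating function, hence control of
second moments of the likelihood ratios.

Write `D_n` for the rescaled estimation error. For `c = tv`, condition (1) says that `{D_n < c}` has
shifted probability at most about `1/2`, which is the limiting shifted probability of `{X_n < c}`.
By Neyman–Pearson its probability under `P^n` is then at most about `Φ(c/√v)`. In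
`neymanPearson_identity` the gap is an integral over the symmetric difference of the two events,
with a weight vanishing only at the threshold. A test attaining the bound is therefore
asymptotically the threshold test (`tendsto_symmDiff`). Equality of the level sets for all `c > 0`
is equality of positive parts in probability. The converse holds because negligible events under
`P^n` stay negligible under the shift.

The two-sided statement is the one-sided one applied to `(S, T, g)` and to `(-S, -T, -g)`. The two
one-sided events cover the whole space, so the two-sided probability is the sum of the one-sided
ones minus one. -/

noncomputable section

namespace TangentConeInference

/-! ### Product measures and Hellinger affinity -/

section Products

variable {Ω : Type*} [MeasurableSpace Ω]

/-- Cauchy–Schwarz for real square-integrable functions. -/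
lemma sq_integral_abs_mul_le {μ : Measure Ω} {f g : Ω → ℝ} (hf : MemLp f 2 μ) (hg : MemLp g 2 μ) :
    (∫ x, |f x * g x| ∂μ) ^ 2 ≤ (∫ x, f x ^ 2 ∂μ) * ∫ x, g x ^ 2 ∂μ := by
  have h := integral_mul_le_Lp_mul_Lq_of_nonneg (μ := μ) (p := 2) (q := 2)
    (Real.HolderConjugate.two_two) (f := fun x => |f x|) (g := fun x => |g x|)
    (ae_of_all _ fun x => abs_nonneg _) (ae_of_all _ fun x => abs_nonneg _)
    (by simpa using hf.norm) (by simpa using hg.norm)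
  simp only [Real.rpow_two, sq_abs, ← abs_mul, ← Real.sqrt_eq_rpow] at h
  have h0 : 0 ≤ ∫ x, |f x * g x| ∂μ := integral_nonneg fun x => abs_nonneg _
  calc (∫ x, |f x * g x| ∂μ) ^ 2
      ≤ (√(∫ x, f x ^ 2 ∂μ) * √(∫ x, g x ^ 2 ∂μ)) ^ 2 := by gcongr
    _ = _ := by
      rw [mul_pow, Real.sq_sqrt (integral_nonneg fun x => sq_nonneg _),
        Real.sq_sqrt (integral_nonneg fun x => sq_nonneg _)]

/-- The power of a measure with a density has the product density. -/
lemma pi_withDensity_ofReal {μ : Measure Ω} [IsFiniteMeasure μ] {q : Ω → ℝ}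
    (hq0 : ∀ x, 0 ≤ q x) (hqi : Integrable q μ) (n : ℕ) :
    Measure.pi (fun _ : Fin n => μ.withDensity fun x => ENNReal.ofReal (q x)) =
      (Measure.pi fun _ : Fin n => μ).withDensity fun x => ENNReal.ofReal (∏ i, q (x i)) := by
  have : IsFiniteMeasure (μ.withDensity fun x => ENNReal.ofReal (q x)) :=
    isFiniteMeasure_withDensity_ofReal hqi.2
  refine Measure.pi_eq fun s hs => ?_
  rw [withDensity_apply _ (MeasurableSet.univ_pi hs), Measure.restrict_pi_pi,
    ← ofReal_integral_eq_lintegral_ofReal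
      (Integrable.fintype_prod (f := fun _ : Fin n => q) fun i => hqi.restrict)
      (ae_of_all _ fun x => Finset.prod_nonneg fun i _ => hq0 _),
    integral_fintype_prod_eq_prod (fun _ : Fin n => q),
    ENNReal.ofReal_prod_of_nonneg fun i _ => integral_nonneg hq0]
  refine Finset.prod_congr rfl fun i _ => ?_
  rw [withDensity_apply _ (hs i), ofReal_integral_eq_lintegral_ofReal hqi.restrict
    (ae_of_all _ hq0)]

lemma pi_withDensity_real_apply {μ : Measure Ω} [IsFiniteMeasure μ] {q : Ω → ℝ}
    (hq0 : ∀ x, 0 ≤ q x) (hqi : Integrable q μ) {n : ℕ}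
    {A : Set (Fin n → Ω)} (hA : MeasurableSet A) :
    (Measure.pi (fun _ : Fin n => μ.withDensity fun x => ENNReal.ofReal (q x))).real A =
      ∫ x in A, ∏ i, q (x i) ∂(Measure.pi fun _ : Fin n => μ) := by
  rw [pi_withDensity_ofReal hq0 hqi, measureReal_def, withDensity_apply _ hA,
    ← ofReal_integral_eq_lintegral_ofReal
      (Integrable.fintype_prod (f := fun _ : Fin n => q) fun i => hqi).restrict
      (ae_of_all _ fun x => Finset.prod_nonneg fun i _ => hq0 _),
    ENNReal.toReal_ofReal (integral_nonneg fun x => Finset.prod_nonneg fun i _ => hq0 _)]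

lemma integrable_prod_pow {μ : Measure Ω} [IsFiniteMeasure μ] {f : Ω → ℝ} (hf : Integrable f μ)
    (n : ℕ) : Integrable (fun x : Fin n → Ω => ∏ i, f (x i)) (Measure.pi fun _ => μ) :=
  Integrable.fintype_prod (f := fun _ : Fin n => f) fun _ => hf

lemma integral_prod_pow {μ : Measure Ω} [IsFiniteMeasure μ] (f : Ω → ℝ) (n : ℕ) :
    ∫ x : Fin n → Ω, ∏ i, f (x i) ∂(Measure.pi fun _ => μ) = (∫ x, f x ∂μ) ^ n := by
  simpa using integral_fintype_prod_eq_pow (ι := Fin n) (μ := μ) f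

/-- The total variation distance of two powers is controlled by the Hellinger affinities of
the factors. -/
lemma sq_pi_sub_pi_le {μ : Measure Ω} [IsFiniteMeasure μ] {u w : Ω → ℝ} (hu : Measurable u)
    (hw : Measurable w) (hu2 : MemLp u 2 μ) (hw2 : MemLp w 2 μ) {n : ℕ} {A : Set (Fin n → Ω)}
    (hA : MeasurableSet A) :
    ((Measure.pi (fun _ : Fin n => μ.withDensity fun x => ENNReal.ofReal (u x ^ 2))).real A -
      (Measure.pi (fun _ : Fin n => μ.withDensity fun x => ENNReal.ofReal (w x ^ 2))).real A) ^ 2 ≤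
    ((∫ x, u x ^ 2 ∂μ) ^ n + (∫ x, w x ^ 2 ∂μ) ^ n - 2 * (∫ x, u x * w x ∂μ) ^ n) *
      (2 * ((∫ x, u x ^ 2 ∂μ) ^ n + (∫ x, w x ^ 2 ∂μ) ^ n)) := by
  have iu := hu2.integrable_sq
  have iw := hw2.integrable_sq
  have iuw : Integrable (fun x => u x * w x) μ := hu2.integrable_mul hw2
  set ν : Measure (Fin n → Ω) := Measure.pi fun _ => μ
  set U : (Fin n → Ω) → ℝ := fun x => ∏ i, u (x i)
  set W : (Fin n → Ω) → ℝ := fun x => ∏ i, w (x i)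
  have hU : Measurable U := by fun_prop
  have hW : Measurable W := by fun_prop
  have hUe : (fun x => U x ^ 2) = fun x => ∏ i, u (x i) ^ 2 := by
    ext x; simp [U, Finset.prod_pow]
  have hWe : (fun x => W x ^ 2) = fun x => ∏ i, w (x i) ^ 2 := by
    ext x; simp [W, Finset.prod_pow]
  have hUWe : (fun x => U x * W x) = fun x => ∏ i, u (x i) * w (x i) := by
    ext x; simp [U, W, Finset.prod_mul_distrib]
  have IU : Integrable (fun x => U x ^ 2) ν := hUe ▸ integrable_prod_pow iu n
  have IW : Integrable (fun x => W x ^ 2) ν := hWe ▸ integrable_prod_pow iw n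
  have IUW : Integrable (fun x => U x * W x) ν := hUWe ▸ integrable_prod_pow iuw n
  have MU : MemLp U 2 ν := (memLp_two_iff_integrable_sq hU.aestronglyMeasurable).2 IU
  have MW : MemLp W 2 ν := (memLp_two_iff_integrable_sq hW.aestronglyMeasurable).2 IW
  have eU : ∫ x, U x ^ 2 ∂ν = (∫ x, u x ^ 2 ∂μ) ^ n := by
    rw [hUe]; exact integral_prod_pow (fun x => u x ^ 2) n
  have eW : ∫ x, W x ^ 2 ∂ν = (∫ x, w x ^ 2 ∂μ) ^ n := by
    rw [hWe]; exact integral_prod_pow (fun x => w x ^ 2) n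
  have eUW : ∫ x, U x * W x ∂ν = (∫ x, u x * w x ∂μ) ^ n := by
    rw [hUWe]; exact integral_prod_pow (fun x => u x * w x) n
  rw [pi_withDensity_real_apply (fun x => sq_nonneg _) iu hA,
    pi_withDensity_real_apply (fun x => sq_nonneg _) iw hA]
  change (∫ x in A, (fun x => ∏ i, u (x i) ^ 2) x ∂ν -
    ∫ x in A, (fun x => ∏ i, w (x i) ^ 2) x ∂ν) ^ 2 ≤ _
  rw [← hUe, ← hWe, ← integral_sub IU.restrict IW.restrict, ← sq_abs]
  have Iadd : Integrable (fun x => U x ^ 2 + W x ^ 2) ν := IU.add IW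
  have e1 : ∫ x, (U - W) x ^ 2 ∂ν =
      (∫ x, u x ^ 2 ∂μ) ^ n + (∫ x, w x ^ 2 ∂μ) ^ n - 2 * (∫ x, u x * w x ∂μ) ^ n := by
    rw [← eU, ← eW, ← eUW, ← integral_const_mul, ← integral_add IU IW,
      ← integral_sub Iadd (IUW.const_mul 2)]
    exact integral_congr_ae (ae_of_all _ fun x => by simp only [Pi.sub_apply]; ring)
  have e2 : ∫ x, (U + W) x ^ 2 ∂ν ≤
      2 * ((∫ x, u x ^ 2 ∂μ) ^ n + (∫ x, w x ^ 2 ∂μ) ^ n) := by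
    rw [← eU, ← eW, ← integral_add IU IW, ← integral_const_mul]
    refine integral_mono (MU.add MW).integrable_sq (Iadd.const_mul 2) fun x => ?_
    simp only [Pi.add_apply]
    nlinarith [sq_nonneg (U x - W x)]
  -- Factor `U² - W² = (U - W)(U + W)` and apply Cauchy–Schwarz. The first factor is the squared
  -- Hellinger distance, whose cross term is the `n`-th power of the affinity.
  calc |∫ x in A, (U x ^ 2 - W x ^ 2) ∂ν| ^ 2
      ≤ (∫ x, |(U - W) x * (U + W) x| ∂ν) ^ 2 := by
        have hi : Integrable (fun x => |(U - W) x * (U + W) x|) ν :=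
          ((MU.sub MW).integrable_mul (MU.add MW)).abs
        gcongr
        refine (abs_integral_le_integral_abs).trans ?_
        refine le_trans (le_of_eq ?_)
          (setIntegral_le_integral (s := A) hi (ae_of_all _ fun x => abs_nonneg _))
        refine integral_congr_ae (ae_of_all _ fun x => ?_)
        simp only [Pi.sub_apply, Pi.add_apply]
        congr 1; ring
    _ ≤ (∫ x, (U - W) x ^ 2 ∂ν) * ∫ x, (U + W) x ^ 2 ∂ν :=
        sq_integral_abs_mul_le (MU.sub MW) (MU.add MW)
    _ ≤ _ := by
        rw [← e1]
        gcongr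

end Products

/-! ### Hellinger comparison of local alternatives -/

section LocalDensities

variable {Ω : Type*} [MeasurableSpace Ω]

lemma sq_toReal_eLpNorm_two {μ : Measure Ω} {f : Ω → ℝ} (hf : MemLp f 2 μ) :
    (eLpNorm f 2 μ).toReal ^ 2 = ∫ x, f x ^ 2 ∂μ := by
  rw [hf.eLpNorm_eq_integral_rpow_norm (by simp) (by simp), ENNReal.toReal_ofReal (by positivity)]
  simp only [ENNReal.toReal_ofNat, Real.rpow_two, Real.norm_eq_abs, sq_abs]
  rw [← Real.rpow_natCast, ← Real.rpow_mul (integral_nonneg fun x => sq_nonneg _)]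
  norm_num

/-- Multiplication by `√p` carries `L₂(p • μ)` isometrically into `L₂(μ)`. It brings root densities
relative to `P` into the space where the Hellinger distance is computed. -/
lemma integral_mul_sqrt_density {μ : Measure Ω} {p : Ω → ℝ} (mp : Measurable p)
    (p0 : ∀ x, 0 ≤ p x) (f : Ω → ℝ) :
    ∫ x, (f x * √(p x)) ^ 2 ∂μ =
      ∫ x, f x ^ 2 ∂(μ.withDensity fun x => ENNReal.ofReal (p x)) := by
  rw [integral_withDensity_eq_integral_toReal_smul (by fun_prop) (by simp)]
  refine integral_congr_ae (ae_of_all _ fun x => ?_)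
  simp only [mul_pow, smul_eq_mul]
  rw [Real.sq_sqrt (p0 x), ENNReal.toReal_ofReal (p0 x), mul_comm]

lemma memLp_mul_sqrt_density {μ : Measure Ω} {p : Ω → ℝ} (mp : Measurable p)
    (p0 : ∀ x, 0 ≤ p x) {f : Ω → ℝ} (hf : Measurable f)
    (hf2 : MemLp f 2 (μ.withDensity fun x => ENNReal.ofReal (p x))) :
    MemLp (fun x => f x * √(p x)) 2 μ := by
  rw [memLp_two_iff_integrable_sq (by fun_prop)]
  have := (integrable_withDensity_iff_integrable_smul' (by fun_prop) (by simp)).1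
    hf2.integrable_sq
  refine this.congr (ae_of_all _ fun x => ?_)
  simp only [mul_pow, smul_eq_mul]
  rw [Real.sq_sqrt (p0 x), ENNReal.toReal_ofReal (p0 x), mul_comm]

/-- Comparison of the powers of `q • μ` and of `ρ² p • μ` in terms of the Hellinger affinity of the
factors. -/
lemma exists_affinity_of_density {μ : Measure Ω} [IsFiniteMeasure μ] {p q g ρ : Ω → ℝ}
    (mp : Measurable p) (mq : Measurable q) (p0 : ∀ x, 0 ≤ p x) (q0 : ∀ x, 0 ≤ q x)
    (qi : Integrable q μ) (q1 : ∫ x, q x ∂μ = 1)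
    {P : Measure Ω} [IsProbabilityMeasure P]
    (hP : μ.withDensity (fun x => ENNReal.ofReal (p x)) = P) (hg : Measurable g)
    (hg2 : MemLp g 2 P) (hρ : Measurable ρ) (hρ2 : MemLp ρ 2 P) (s : ℝ) :
    ∃ a : ℝ, 0 ≤ 1 + ∫ x, ρ x ^ 2 ∂P - 2 * a ∧
      1 + ∫ x, ρ x ^ 2 ∂P - 2 * a ≤
        2 * (eLpNorm (fun x => √(q x) - (1 + s / 2 * g x) * √(p x)) 2 μ).toReal ^ 2 +
        2 * ∫ x, (ρ x - (1 + s / 2 * g x)) ^ 2 ∂P ∧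
      ∀ (n : ℕ) (A : Set (Fin n → Ω)), MeasurableSet A →
        ((Measure.pi fun _ : Fin n => μ.withDensity fun x => ENNReal.ofReal (q x)).real A -
          ∫ x in A, ∏ i, ρ (x i) ^ 2 ∂(Measure.pi fun _ : Fin n => P)) ^ 2 ≤
          (1 + (∫ x, ρ x ^ 2 ∂P) ^ n - 2 * a ^ n) * (2 * (1 + (∫ x, ρ x ^ 2 ∂P) ^ n)) := by
  subst hP
  set P := μ.withDensity fun x => ENNReal.ofReal (p x)
  set u : Ω → ℝ := fun x => √(q x) with hu
  set w : Ω → ℝ := fun x => ρ x * √(p x) with hw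
  have mu : Measurable u := by fun_prop
  have mw : Measurable w := by fun_prop
  have eu : (fun x => u x ^ 2) = q := by ext x; exact Real.sq_sqrt (q0 x)
  have u2 : MemLp u 2 μ := by
    rw [memLp_two_iff_integrable_sq mu.aestronglyMeasurable, eu]
    exact qi
  have w2 : MemLp w 2 μ := memLp_mul_sqrt_density mp p0 hρ hρ2
  have iu : ∫ x, u x ^ 2 ∂μ = 1 := by rw [eu, q1]
  have iw : ∫ x, w x ^ 2 ∂μ = ∫ x, ρ x ^ 2 ∂P := integral_mul_sqrt_density mp p0 ρ
  have iuw : Integrable (fun x => u x * w x) μ := u2.integrable_mul w2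
  have diff : ∫ x, (u x - w x) ^ 2 ∂μ =
      1 + ∫ x, ρ x ^ 2 ∂P - 2 * ∫ x, u x * w x ∂μ := by
    have I : Integrable (fun x => u x ^ 2 + w x ^ 2) μ := u2.integrable_sq.add w2.integrable_sq
    rw [← iw, ← iu, ← integral_const_mul, ← integral_add u2.integrable_sq w2.integrable_sq,
      ← integral_sub I (iuw.const_mul 2)]
    exact integral_congr_ae (ae_of_all _ fun x => by simp only; ring)
  have l2 : MemLp (fun x => 1 + s / 2 * g x) 2 P :=
    MemLp.add (f := fun _ => (1 : ℝ)) (memLp_const 1) (hg2.const_mul (s / 2))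
  set R : Ω → ℝ := fun x => u x - (1 + s / 2 * g x) * √(p x) with hR
  have R2 : MemLp R 2 μ := u2.sub (memLp_mul_sqrt_density mp p0 (by fun_prop) l2)
  set e : Ω → ℝ := fun x => ρ x - (1 + s / 2 * g x) with he
  have e2 : MemLp (fun x => e x * √(p x)) 2 μ :=
    memLp_mul_sqrt_density mp p0 (by fun_prop) (hρ2.sub l2)
  refine ⟨∫ x, u x * w x ∂μ, ?_, ?_, ?_⟩
  · rw [← diff]; exact integral_nonneg fun x => sq_nonneg _
  · rw [← diff, sq_toReal_eLpNorm_two R2, ← integral_mul_sqrt_density mp p0 e,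
      ← integral_const_mul, ← integral_const_mul,
      ← integral_add (R2.integrable_sq.const_mul 2) (e2.integrable_sq.const_mul 2)]
    refine integral_mono (u2.sub w2).integrable_sq ((R2.integrable_sq.const_mul 2).add
        (e2.integrable_sq.const_mul 2)) fun x => ?_
    -- Both root densities are compared with the linear one `(1 + (s/2) g)√p`. The factors `2` come
    -- from `(R - E)² ≤ 2R² + 2E²`.
    have : u x - w x = R x - e x * √(p x) := by
      simp only [hR, hw, he]; ring
    simp only
    rw [this]
    nlinarith [sq_nonneg (R x + e x * √(p x))]
  · intro n A hA
    have h := sq_pi_sub_pi_le mu mw u2 w2 hA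
    have hw' : (μ.withDensity fun x => ENNReal.ofReal (w x ^ 2)) =
        P.withDensity fun x => ENNReal.ofReal (ρ x ^ 2) := by
      rw [← withDensity_mul _ (by fun_prop) (by fun_prop)]
      congr 1
      ext x
      rw [Pi.mul_apply, ← ENNReal.ofReal_mul (p0 x), hw]
      simp only [mul_pow]
      rw [Real.sq_sqrt (p0 x), mul_comm]
    have hu' : (fun x => ENNReal.ofReal (u x ^ 2)) = fun x => ENNReal.ofReal (q x) := by
      rw [← eu]
    rw [iu, iw, one_pow, hw', hu',
      pi_withDensity_real_apply (fun x => sq_nonneg _) hρ2.integrable_sq hA] at h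
    exact h

lemma withDensity_toReal_rnDeriv {μ ν : Measure Ω} [IsFiniteMeasure μ] [IsFiniteMeasure ν]
    (h : ν ≪ μ) : μ.withDensity (fun x => ENNReal.ofReal (ν.rnDeriv μ x).toReal) = ν := by
  conv_rhs => rw [← Measure.withDensity_rnDeriv_eq _ _ h]
  refine withDensity_congr_ae ?_
  filter_upwards [Measure.rnDeriv_lt_top ν μ] with x hx
  exact ENNReal.ofReal_toReal hx.ne

/-- Comparison of `Q^n` with the power of the measure with root density `ρ` with respect
to `P`, in terms of their Hellinger affinity. -/
lemma exists_affinity (P Q : ProbabilityMeasure Ω) {g ρ : Ω → ℝ} (hg : Measurable g)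
    (hg2 : MemLp g 2 (P : Measure Ω)) (hρ : Measurable ρ)
    (hρ2 : MemLp ρ 2 (P : Measure Ω)) (s : ℝ) :
    ∃ a : ℝ, 0 ≤ 1 + ∫ x, ρ x ^ 2 ∂(P : Measure Ω) - 2 * a ∧
      1 + ∫ x, ρ x ^ 2 ∂(P : Measure Ω) - 2 * a ≤ 2 * (rootRemainder P Q g s).toReal ^ 2 +
        2 * ∫ x, (ρ x - (1 + s / 2 * g x)) ^ 2 ∂(P : Measure Ω) ∧
      ∀ (n : ℕ) (A : Set (Fin n → Ω)), MeasurableSet A →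
        ((iidLaw Q n).real A - ∫ x in A, ∏ i, ρ (x i) ^ 2 ∂(iidLaw P n)) ^ 2 ≤
          (1 + (∫ x, ρ x ^ 2 ∂(P : Measure Ω)) ^ n - 2 * a ^ n) *
            (2 * (1 + (∫ x, ρ x ^ 2 ∂(P : Measure Ω)) ^ n)) := by
  have hP : (P : Measure Ω) ≪ (P : Measure Ω) + (Q : Measure Ω) :=
    Measure.AbsolutelyContinuous.rfl.add_right _
  have hQ : (Q : Measure Ω) ≪ (P : Measure Ω) + (Q : Measure Ω) := by
    rw [add_comm]; exact Measure.AbsolutelyContinuous.rfl.add_right _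
  have h := exists_affinity_of_density (s := s)
    (Measure.measurable_rnDeriv (P : Measure Ω) _).ennreal_toReal
    (Measure.measurable_rnDeriv (Q : Measure Ω) _).ennreal_toReal
    (fun x => ENNReal.toReal_nonneg) (fun x => ENNReal.toReal_nonneg)
    Measure.integrable_toReal_rnDeriv
    (by rw [Measure.integral_toReal_rnDeriv hQ]; simp)
    (withDensity_toReal_rnDeriv hP) hg hg2 hρ hρ2
  rw [withDensity_toReal_rnDeriv hQ] at h
  exact h

/-- Local asymptotic normality in the total variation form: if the measures with root densities
`ρ n` with respect to `P` are tangent to `Q n` to the order `o(n^{-1/2})` in Hellinger distance,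
the product laws are asymptotically equivalent. -/
lemma tendsto_iidLaw_sub {P : ProbabilityMeasure Ω} {Q : ℕ → ProbabilityMeasure Ω} {g : Ω → ℝ}
    {ρ : ℕ → Ω → ℝ} (hg : Measurable g) (hg2 : MemLp g 2 (P : Measure Ω))
    (hρ : ∀ n, Measurable (ρ n)) (hρ2 : ∀ n, MemLp (ρ n) 2 (P : Measure Ω)) {t : ℝ} (ht : 0 < t)
    (hQ : Tendsto (fun n : ℕ => rootRemainder P (Q n) g (t / √(n : ℝ)) /
      ENNReal.ofReal (t / √(n : ℝ))) atTop (𝓝 0))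
    (hmass : Tendsto (fun n : ℕ => (n : ℝ) * (∫ x, ρ n x ^ 2 ∂(P : Measure Ω) - 1)) atTop (𝓝 0))
    (hrem : Tendsto (fun n : ℕ => (n : ℝ) *
      ∫ x, (ρ n x - (1 + t / √(n : ℝ) / 2 * g x)) ^ 2 ∂(P : Measure Ω)) atTop (𝓝 0))
    {A : (n : ℕ) → Set (Fin n → Ω)} (hA : ∀ n, MeasurableSet (A n)) :
    Tendsto (fun n => (iidLaw (Q n) n).real (A n) -
      ∫ x in A n, ∏ i, ρ n (x i) ^ 2 ∂(iidLaw P n)) atTop (𝓝 0) := by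
  choose a ha0 ha1 ha2 using fun n : ℕ => exists_affinity P (Q n) hg hg2 (hρ n) (hρ2 n) (t / √n)
  set β : ℕ → ℝ := fun n => ∫ x, ρ n x ^ 2 ∂(P : Measure Ω) with hβ
  -- With `s = t/√n` one has `n = t²/s²`, so a remainder `o(s)` contributes `o(1)` after squaring
  -- and multiplying by `n`.
  have hR : Tendsto (fun n : ℕ => (n : ℝ) * (rootRemainder P (Q n) g (t / √(n : ℝ))).toReal ^ 2)
      atTop (𝓝 0) := by
    have h1 := ((ENNReal.tendsto_toReal ENNReal.zero_ne_top).comp hQ).pow 2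
    have h2 := h1.const_mul (t ^ 2)
    simp only [ENNReal.toReal_zero, ne_eq, OfNat.ofNat_ne_zero, not_false_eq_true, zero_pow,
      mul_zero] at h2
    refine h2.congr' ?_
    filter_upwards [eventually_gt_atTop 0] with n hn
    have hn' : (0 : ℝ) < n := by exact_mod_cast hn
    simp only [Function.comp, ENNReal.toReal_div]
    rw [ENNReal.toReal_ofReal (by positivity), div_pow, div_pow, Real.sq_sqrt hn'.le]
    field_simp
  have hd : Tendsto (fun n : ℕ => (n : ℝ) * (1 + β n - 2 * a n)) atTop (𝓝 0) := by
    refine squeeze_zero (fun n => mul_nonneg (Nat.cast_nonneg n) (ha0 n))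
      (fun n => mul_le_mul_of_nonneg_left (ha1 n) (Nat.cast_nonneg n)) ?_
    have := (hR.const_mul 2).add (hrem.const_mul 2)
    simp only [mul_zero, add_zero] at this
    refine this.congr fun n => ?_
    ring
  have hβ1 : Tendsto (fun n : ℕ => β n ^ n) atTop (𝓝 1) := by
    have := Real.tendsto_one_add_pow_exp_of_tendsto hmass
    simpa using this
  -- The affinity is half of total mass minus squared distance. Both corrections are `o(1/n)`, so
  -- its `n`-th power still tends to `1`.
  have ha1 : Tendsto (fun n : ℕ => a n ^ n) atTop (𝓝 1) := by
    have h1 : Tendsto (fun n : ℕ => (n : ℝ) * (a n - 1)) atTop (𝓝 0) := by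
      have := (hmass.sub hd).const_mul (1 / 2)
      simp only [sub_zero, mul_zero] at this
      refine this.congr fun n => ?_
      simp only [hβ]
      ring
    have := Real.tendsto_one_add_pow_exp_of_tendsto h1
    simpa using this
  have hlim : Tendsto (fun n : ℕ => (1 + β n ^ n - 2 * a n ^ n) * (2 * (1 + β n ^ n)))
      atTop (𝓝 0) := by
    have := ((hβ1.const_add 1).sub (ha1.const_mul 2)).mul ((hβ1.const_add 1).const_mul 2)
    simpa [one_add_one_eq_two] using this
  have hsq := squeeze_zero (fun n => sq_nonneg _) (fun n => ha2 n n (A n) (hA n)) hlim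
  have := hsq.sqrt
  simp only [Real.sqrt_sq_eq_abs, Real.sqrt_zero] at this
  exact (tendsto_zero_iff_abs_tendsto_zero _).2 this

end LocalDensities

/-! ### Truncated tangents and exponential tilts -/

section Truncation

variable {Ω : Type*} [MeasurableSpace Ω]

/-- The function `h`, set to zero where it exceeds `n^{1/4}`. -/
def truncated (h : Ω → ℝ) (n : ℕ) (x : Ω) : ℝ := if |h x| ≤ √√(n : ℝ) then h x else 0

/-- The truncated function, recentred under `P`. -/
def centeredTrunc (P : Measure Ω) (h : Ω → ℝ) (n : ℕ) (x : Ω) : ℝ :=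
  truncated h n x - ∫ y, truncated h n y ∂P

variable {P : Measure Ω} {h : Ω → ℝ}

lemma measurable_truncated (hh : Measurable h) (n : ℕ) : Measurable (truncated h n) :=
  Measurable.ite (measurableSet_le (by fun_prop) (by fun_prop)) hh measurable_const

lemma measurable_centeredTrunc (hh : Measurable h) (n : ℕ) : Measurable (centeredTrunc P h n) :=
  (measurable_truncated hh n).sub measurable_const

lemma abs_truncated_le {α : Type*} (h : α → ℝ) (n : ℕ) (x : α) : |truncated h n x| ≤ √√(n : ℝ) := by
  unfold truncated
  split_ifs with hx
  · exact hx
  · simp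

lemma abs_truncated_le_abs {α : Type*} (h : α → ℝ) (n : ℕ) (x : α) : |truncated h n x| ≤ |h x| := by
  unfold truncated
  split_ifs with hx
  · exact le_rfl
  · simp

lemma abs_truncated_sub_le_abs {α : Type*} (h : α → ℝ) (n : ℕ) (x : α) : |truncated h n x - h x| ≤ |h x| := by
  unfold truncated
  split_ifs with hx <;> simp

lemma truncated_eventually_eq {α : Type*} (h : α → ℝ) (x : α) : ∀ᶠ n : ℕ in atTop, truncated h n x = h x := by
  have : Tendsto (fun n : ℕ => √√(n : ℝ)) atTop atTop :=
    Real.tendsto_sqrt_atTop.comp (Real.tendsto_sqrt_atTop.comp tendsto_natCast_atTop_atTop)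
  filter_upwards [this.eventually_ge_atTop |h x|] with n hn
  simp [truncated, hn]

lemma tendsto_integral_truncated_sub_sq (hh : Measurable h) (hh2 : MemLp h 2 P) :
    Tendsto (fun n => ∫ x, (truncated h n x - h x) ^ 2 ∂P) atTop (𝓝 0) := by
  rw [← integral_zero Ω ℝ (μ := P)]
  refine tendsto_integral_of_dominated_convergence (fun x => h x ^ 2)
    (fun n => (((measurable_truncated hh n).sub hh).pow_const 2).aestronglyMeasurable)
    hh2.integrable_sq
    (fun n => ae_of_all _ fun x => ?_) (ae_of_all _ fun x => ?_)
  · rw [Real.norm_eq_abs, abs_pow, ← sq_abs (h x)]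
    exact pow_le_pow_left₀ (abs_nonneg _) (abs_truncated_sub_le_abs h n x) 2
  · exact tendsto_const_nhds.congr' ((truncated_eventually_eq h x).mono fun n hn => by simp [hn])

/-- The exponent of the exponential tilt of `P` in direction `h`. -/
def tiltExponent (P : Measure Ω) (h : Ω → ℝ) (t : ℝ) (n : ℕ) (x : Ω) : ℝ :=
  t / √(n : ℝ) * centeredTrunc P h n x - t ^ 2 * (∫ y, h y ^ 2 ∂P) / (2 * n)

lemma measurable_tiltExponent (hh : Measurable h) (t : ℝ) (n : ℕ) :
    Measurable (tiltExponent P h t n) :=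
  ((measurable_centeredTrunc hh n).const_mul _).sub measurable_const

lemma tendsto_integral_truncated_sq (hh : Measurable h) (hh2 : MemLp h 2 P) :
    Tendsto (fun n => ∫ x, truncated h n x ^ 2 ∂P) atTop (𝓝 (∫ x, h x ^ 2 ∂P)) := by
  refine tendsto_integral_of_dominated_convergence (fun x => h x ^ 2)
    (fun n => ((measurable_truncated hh n).pow_const 2).aestronglyMeasurable)
    hh2.integrable_sq
    (fun n => ae_of_all _ fun x => ?_) (ae_of_all _ fun x => ?_)
  · rw [Real.norm_eq_abs, abs_pow, ← sq_abs (h x)]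
    exact pow_le_pow_left₀ (abs_nonneg _) (abs_truncated_le_abs h n x) 2
  · exact tendsto_const_nhds.congr' ((truncated_eventually_eq h x).mono fun n hn => by simp only [hn])

variable [IsProbabilityMeasure P]

lemma abs_centeredTrunc_le (h : Ω → ℝ) (n : ℕ) (x : Ω) :
    |centeredTrunc P h n x| ≤ 2 * √√(n : ℝ) := by
  have h1 : |∫ y, truncated h n y ∂P| ≤ √√(n : ℝ) := by
    have := norm_integral_le_of_norm_le_const (μ := P) (f := truncated h n) (C := √√(n : ℝ))
      (ae_of_all _ fun y => abs_truncated_le h n y)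
    simpa using this
  have := abs_sub (truncated h n x) (∫ y, truncated h n y ∂P)
  unfold centeredTrunc
  linarith [abs_truncated_le h n x]

lemma memLp_centeredTrunc (hh : Measurable h) (n : ℕ) (p : ENNReal) :
    MemLp (centeredTrunc P h n) p P :=
  MemLp.of_bound (measurable_centeredTrunc hh n).aestronglyMeasurable _
    (ae_of_all _ fun x => abs_centeredTrunc_le h n x)

lemma memLp_truncated (hh : Measurable h) (n : ℕ) (p : ENNReal) :
    MemLp (truncated h n) p P :=
  MemLp.of_bound (measurable_truncated hh n).aestronglyMeasurable _
    (ae_of_all _ fun x => abs_truncated_le h n x)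

lemma integral_centeredTrunc (hh : Measurable h) (n : ℕ) : ∫ x, centeredTrunc P h n x ∂P = 0 := by
  unfold centeredTrunc
  rw [integral_sub ((memLp_truncated hh n 1).integrable le_rfl) (integrable_const _)]
  simp

lemma integral_sq_sub_integral {f : Ω → ℝ} (hf : MemLp f 2 P) :
    ∫ x, (f x - ∫ y, f y ∂P) ^ 2 ∂P = ∫ x, f x ^ 2 ∂P - (∫ x, f x ∂P) ^ 2 := by
  rw [← variance_eq_integral hf.aestronglyMeasurable.aemeasurable, variance_eq_sub hf]
  rfl

lemma tendsto_integral_truncated (hh : Measurable h) (hh2 : MemLp h 2 P) :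
    Tendsto (fun n => ∫ x, truncated h n x ∂P) atTop (𝓝 (∫ x, h x ∂P)) := by
  refine tendsto_integral_of_dominated_convergence (fun x => |h x|)
    (fun n => (measurable_truncated hh n).aestronglyMeasurable)
    (hh2.integrable (by norm_num)).abs
    (fun n => ae_of_all _ fun x => abs_truncated_le_abs h n x) (ae_of_all _ fun x => ?_)
  exact tendsto_const_nhds.congr' ((truncated_eventually_eq h x).mono fun n hn => hn.symm)

lemma tendsto_integral_centeredTrunc_sq (hh : Measurable h) (hh2 : MemLp h 2 P)
    (h0 : ∫ x, h x ∂P = 0) :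
    Tendsto (fun n => ∫ x, centeredTrunc P h n x ^ 2 ∂P) atTop (𝓝 (∫ x, h x ^ 2 ∂P)) := by
  have := (tendsto_integral_truncated_sq hh hh2).sub ((tendsto_integral_truncated hh hh2).pow 2)
  rw [h0] at this
  simp only [ne_eq, OfNat.ofNat_ne_zero, not_false_eq_true, zero_pow, sub_zero] at this
  refine this.congr fun n => ?_
  rw [← integral_sq_sub_integral (memLp_truncated hh n 2)]
  rfl

/-- As `h` has mean zero, recentring subtracts exactly the mean of `truncated h n - h`, and a
variance is at most the second moment. -/
lemma tendsto_integral_centeredTrunc_sub_sq (hh : Measurable h) (hh2 : MemLp h 2 P)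
    (h0 : ∫ x, h x ∂P = 0) :
    Tendsto (fun n => ∫ x, (centeredTrunc P h n x - h x) ^ 2 ∂P) atTop (𝓝 0) := by
  refine squeeze_zero (fun n => integral_nonneg fun x => sq_nonneg _) (fun n => ?_)
    (tendsto_integral_truncated_sub_sq hh hh2)
  have hm : MemLp (fun x => truncated h n x - h x) 2 P := (memLp_truncated hh n 2).sub hh2
  have h1 := integral_sq_sub_integral hm
  have h2 : ∫ x, (truncated h n x - h x) ∂P = ∫ x, truncated h n x ∂P := by
    rw [integral_sub ((memLp_truncated hh n 1).integrable le_rfl)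
      (hh2.integrable (by norm_num)), h0, sub_zero]
  have h3 : ∀ x, centeredTrunc P h n x - h x =
      truncated h n x - h x - ∫ y, truncated h n y ∂P := fun x => by
    unfold centeredTrunc; ring
  rw [h2] at h1
  simp_rw [h3, h1]
  nlinarith [sq_nonneg (∫ x, truncated h n x ∂P)]

/-- A bound of the exponent, uniform on the space. -/
def tiltBound (P : Measure Ω) (h : Ω → ℝ) (t : ℝ) (n : ℕ) : ℝ :=
  |t| * 2 * (√√(n : ℝ))⁻¹ + t ^ 2 * (∫ y, h y ^ 2 ∂P) / 2 * (n : ℝ)⁻¹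

/-- The truncation level `n^{1/4}` divided by `√n` is `n^{-1/4}`. The exponent thus tends to zero
uniformly, which makes every Taylor expansion of the tilt uniform. -/
lemma abs_tiltExponent_le (h : Ω → ℝ) (t : ℝ) (n : ℕ) (x : Ω) :
    |tiltExponent P h t n x| ≤ tiltBound P h t n := by
  have hv : 0 ≤ ∫ y, h y ^ 2 ∂P := integral_nonneg fun y => sq_nonneg _
  have h1 : |t / √(n : ℝ) * centeredTrunc P h n x| ≤ |t| * 2 * (√√(n : ℝ))⁻¹ := by
    rw [abs_mul, abs_div, abs_of_nonneg (Real.sqrt_nonneg _)]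
    calc |t| / √(n : ℝ) * |centeredTrunc P h n x| ≤ |t| / √(n : ℝ) * (2 * √√(n : ℝ)) := by
          gcongr; exact abs_centeredTrunc_le h n x
      _ = |t| * 2 * (√√(n : ℝ) / √(n : ℝ)) := by ring
      _ = _ := by rw [Real.sqrt_div_self', one_div]
  have h2 : |t ^ 2 * (∫ y, h y ^ 2 ∂P) / (2 * n)| =
      t ^ 2 * (∫ y, h y ^ 2 ∂P) / 2 * (n : ℝ)⁻¹ := by
    rw [abs_of_nonneg (by positivity), div_mul_eq_div_div, div_eq_mul_inv _ (n : ℝ)]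
  have := abs_sub (t / √(n : ℝ) * centeredTrunc P h n x) (t ^ 2 * (∫ y, h y ^ 2 ∂P) / (2 * n))
  unfold tiltExponent tiltBound
  linarith

lemma tendsto_tiltBound (P : Measure Ω) (h : Ω → ℝ) (t : ℝ) :
    Tendsto (tiltBound P h t) atTop (𝓝 0) := by
  have h1 : Tendsto (fun n : ℕ => (√√(n : ℝ))⁻¹) atTop (𝓝 0) :=
    (Real.tendsto_sqrt_atTop.comp
      (Real.tendsto_sqrt_atTop.comp tendsto_natCast_atTop_atTop)).inv_tendsto_atTop
  have := (h1.const_mul (|t| * 2)).add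
    ((tendsto_inv_atTop_nhds_zero_nat (𝕜 := ℝ)).const_mul (t ^ 2 * (∫ y, h y ^ 2 ∂P) / 2))
  rw [mul_zero, mul_zero, add_zero] at this
  exact this

lemma integrable_comp_tiltExponent (hh : Measurable h) (t : ℝ) (n : ℕ) {f : ℝ → ℝ}
    (hf : Continuous f) : Integrable (fun x => f (tiltExponent P h t n x)) P := by
  obtain ⟨C, hC⟩ := (isCompact_Icc (a := -tiltBound P h t n)
    (b := tiltBound P h t n)).exists_bound_of_continuousOn hf.continuousOn
  exact Integrable.of_bound
    (hf.measurable.comp (measurable_tiltExponent hh t n)).aestronglyMeasurable C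
    (ae_of_all _ fun x => hC _ (abs_le.1 (abs_tiltExponent_le h t n x)))

lemma integral_tiltExponent (hh : Measurable h) (t : ℝ) (n : ℕ) :
    ∫ x, tiltExponent P h t n x ∂P = -(t ^ 2 * (∫ y, h y ^ 2 ∂P) / (2 * n)) := by
  unfold tiltExponent
  rw [integral_sub (((memLp_centeredTrunc hh n 1).integrable le_rfl).const_mul _)
    (integrable_const _), integral_const_mul, integral_centeredTrunc hh]
  simp

lemma integral_tiltExponent_sq (hh : Measurable h) (t : ℝ) (n : ℕ) :
    ∫ x, tiltExponent P h t n x ^ 2 ∂P =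
      t ^ 2 / n * ∫ x, centeredTrunc P h n x ^ 2 ∂P +
        (t ^ 2 * (∫ y, h y ^ 2 ∂P) / (2 * n)) ^ 2 := by
  set d := t ^ 2 * (∫ y, h y ^ 2 ∂P) / (2 * n) with hd
  have e : ∀ x, tiltExponent P h t n x ^ 2 = t ^ 2 / n * centeredTrunc P h n x ^ 2 +
      (d ^ 2 - 2 * d * (t / √(n : ℝ)) * centeredTrunc P h n x) := fun x => by
    have : (t / √(n : ℝ)) ^ 2 = t ^ 2 / n := by
      rw [div_pow, Real.sq_sqrt (Nat.cast_nonneg n)]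
    rw [← this, tiltExponent, ← hd]; ring
  have i1 : Integrable (fun x => t ^ 2 / n * centeredTrunc P h n x ^ 2) P :=
    (memLp_centeredTrunc hh n 2).integrable_sq.const_mul _
  have i2 : Integrable (fun x => 2 * d * (t / √(n : ℝ)) * centeredTrunc P h n x) P :=
    ((memLp_centeredTrunc hh n 1).integrable le_rfl).const_mul _
  have i3 : Integrable (fun x => d ^ 2 - 2 * d * (t / √(n : ℝ)) * centeredTrunc P h n x) P :=
    (integrable_const _).sub i2
  simp_rw [e]
  rw [integral_add i1 i3, integral_sub (integrable_const _) i2,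
    integral_const_mul, integral_const_mul, integral_centeredTrunc hh]
  simp

lemma tendsto_mul_integral_tiltExponent_sq (hh : Measurable h) (hh2 : MemLp h 2 P)
    (h0 : ∫ x, h x ∂P = 0) (t : ℝ) :
    Tendsto (fun n : ℕ => (n : ℝ) * ∫ x, tiltExponent P h t n x ^ 2 ∂P) atTop
      (𝓝 (t ^ 2 * ∫ x, h x ^ 2 ∂P)) := by
  have h1 := ((tendsto_integral_centeredTrunc_sq hh hh2 h0).const_mul (t ^ 2)).add
    ((tendsto_inv_atTop_nhds_zero_nat (𝕜 := ℝ)).const_mul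
      ((t ^ 2 * (∫ y, h y ^ 2 ∂P) / 2) ^ 2))
  rw [mul_zero, add_zero] at h1
  refine h1.congr' ?_
  filter_upwards [eventually_gt_atTop 0] with n hn
  have hn' : (n : ℝ) ≠ 0 := by positivity
  rw [integral_tiltExponent_sq hh]
  field_simp

lemma abs_exp_sub_quadratic_le {b : ℝ} (hb : |b| ≤ 1) :
    |Real.exp b - 1 - b - b ^ 2 / 2| ≤ |b| ^ 3 := by
  have := Real.exp_bound hb (n := 3) (by norm_num)
  simp only [Finset.sum_range_succ, Finset.sum_range_zero, Nat.factorial] at this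
  norm_num at this
  have h3 : 0 ≤ |b| ^ 3 := by positivity
  have e : Real.exp b - 1 - b - b ^ 2 / 2 = Real.exp b - (1 + b + b ^ 2 / 2) := by ring
  rw [e]
  linarith

/-- The exponential tilt is asymptotically normalized. -/
lemma tendsto_mul_integral_exp_tiltExponent (hh : Measurable h) (hh2 : MemLp h 2 P)
    (h0 : ∫ x, h x ∂P = 0) (t : ℝ) :
    Tendsto (fun n : ℕ => (n : ℝ) * (∫ x, Real.exp (tiltExponent P h t n x) ∂P - 1)) atTop
      (𝓝 0) := by
  have hsq := tendsto_mul_integral_tiltExponent_sq hh hh2 h0 t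
  -- The drift subtracted in the exponent contributes `-t²v/2`, which cancels half of the limiting
  -- second moment `t²v`.
  have hmain : Tendsto (fun n : ℕ => (n : ℝ) * (∫ x, tiltExponent P h t n x ∂P +
      (∫ x, tiltExponent P h t n x ^ 2 ∂P) / 2)) atTop (𝓝 0) := by
    have h1 := (hsq.div_const 2).sub_const (t ^ 2 * (∫ x, h x ^ 2 ∂P) / 2)
    rw [sub_self] at h1
    refine h1.congr' ?_
    filter_upwards [eventually_gt_atTop 0] with n hn
    have hn' : (n : ℝ) ≠ 0 := by positivity
    rw [integral_tiltExponent hh]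
    field_simp
    ring
  have hrem : Tendsto (fun n : ℕ => (n : ℝ) * ∫ x, (Real.exp (tiltExponent P h t n x) - 1 -
      tiltExponent P h t n x - tiltExponent P h t n x ^ 2 / 2) ∂P) atTop (𝓝 0) := by
    -- The cubic remainder is at most the uniform bound times the square of the exponent, and the
    -- second moment is `O(1/n)`.
    have h1 := (tendsto_tiltBound P h t).mul hsq
    rw [zero_mul] at h1
    refine squeeze_zero_norm' ?_ h1
    filter_upwards [(tendsto_tiltBound P h t).eventually (eventually_le_nhds one_pos)] with n hn
    rw [Real.norm_eq_abs, abs_mul, Nat.abs_cast, mul_left_comm]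
    gcongr
    rw [← integral_const_mul]
    refine (abs_integral_le_integral_abs).trans (integral_mono
      (integrable_comp_tiltExponent hh t n (f := fun b => |Real.exp b - 1 - b - b ^ 2 / 2|)
        (by fun_prop))
      (integrable_comp_tiltExponent hh t n (f := fun b => tiltBound P h t n * b ^ 2)
        (by fun_prop)) fun x => ?_)
    have hb := abs_tiltExponent_le (P := P) h t n x
    calc _ ≤ |tiltExponent P h t n x| ^ 3 := abs_exp_sub_quadratic_le (hb.trans hn)
      _ = |tiltExponent P h t n x| * tiltExponent P h t n x ^ 2 := by rw [← sq_abs]; ring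
      _ ≤ _ := by gcongr
  have := hmain.add hrem
  rw [add_zero] at this
  refine this.congr fun n => ?_
  have I0 := integrable_comp_tiltExponent (P := P) hh t n (f := Real.exp) (by fun_prop)
  have I1 := integrable_comp_tiltExponent (P := P) hh t n (f := fun b => b) (by fun_prop)
  have I2 := integrable_comp_tiltExponent (P := P) hh t n (f := fun b => b ^ 2 / 2) (by fun_prop)
  have I3 := integrable_comp_tiltExponent (P := P) hh t n (f := fun b => Real.exp b - 1)
    (by fun_prop)
  have I4 := integrable_comp_tiltExponent (P := P) hh t n (f := fun b => Real.exp b - 1 - b)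
    (by fun_prop)
  rw [integral_sub I4 I2, integral_sub I3 I1, integral_sub I0 (integrable_const _),
    integral_div]
  simp
  ring

/-- The root density of the exponential tilt has the first order expansion of a path with
tangent `h`. -/
lemma tendsto_mul_integral_root_sub_sq (hh : Measurable h) (hh2 : MemLp h 2 P)
    (h0 : ∫ x, h x ∂P = 0) (t : ℝ) :
    Tendsto (fun n : ℕ => (n : ℝ) * ∫ x, (Real.exp (tiltExponent P h t n x / 2) -
      (1 + t / √(n : ℝ) / 2 * h x)) ^ 2 ∂P) atTop (𝓝 0) := by
  set v := ∫ x, h x ^ 2 ∂P with hv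
  have hsq := tendsto_mul_integral_tiltExponent_sq hh hh2 h0 t
  have hlim : Tendsto (fun n : ℕ => 3 * (tiltBound P h t n ^ 2 *
        ((n : ℝ) * ∫ x, tiltExponent P h t n x ^ 2 ∂P)) +
      3 * (t ^ 2 / 4 * ∫ x, (centeredTrunc P h n x - h x) ^ 2 ∂P) +
      3 * (t ^ 2 * v / 4) ^ 2 * (n : ℝ)⁻¹) atTop (𝓝 0) := by
    have := (((((tendsto_tiltBound P h t).pow 2).mul hsq).const_mul 3).add
      (((tendsto_integral_centeredTrunc_sub_sq hh hh2 h0).const_mul (t ^ 2 / 4)).const_mul 3)).add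
      ((tendsto_inv_atTop_nhds_zero_nat (𝕜 := ℝ)).const_mul (3 * (t ^ 2 * v / 4) ^ 2))
    simpa using this
  refine squeeze_zero' (Eventually.of_forall fun n =>
    mul_nonneg (Nat.cast_nonneg n) (integral_nonneg fun x => sq_nonneg _)) ?_ hlim
  filter_upwards [(tendsto_tiltBound P h t).eventually (eventually_le_nhds one_pos),
    eventually_gt_atTop 0] with n hn hn0
  have hn' : (0 : ℝ) < n := by exact_mod_cast hn0
  have i1 : Integrable (fun x => tiltExponent P h t n x ^ 2) P :=
    integrable_comp_tiltExponent hh t n (f := fun b => b ^ 2) (by fun_prop)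
  have i2 : Integrable (fun x => (centeredTrunc P h n x - h x) ^ 2) P :=
    ((memLp_centeredTrunc hh n 2).sub hh2).integrable_sq
  have j1 := i1.const_mul (3 * tiltBound P h t n ^ 2)
  have j2 := i2.const_mul (3 * (t ^ 2 / (4 * n)))
  have j12 : Integrable (fun x => 3 * tiltBound P h t n ^ 2 * tiltExponent P h t n x ^ 2 +
      3 * (t ^ 2 / (4 * n)) * (centeredTrunc P h n x - h x) ^ 2) P := j1.add j2
  have key : ∫ x, (Real.exp (tiltExponent P h t n x / 2) - (1 + t / √(n : ℝ) / 2 * h x)) ^ 2 ∂P ≤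
      ∫ x, (3 * tiltBound P h t n ^ 2 * tiltExponent P h t n x ^ 2 +
        3 * (t ^ 2 / (4 * n)) * (centeredTrunc P h n x - h x) ^ 2 +
        3 * (t ^ 2 * v / (4 * n)) ^ 2) ∂P := by
    refine integral_mono_of_nonneg (ae_of_all _ fun x => sq_nonneg _)
      (j12.add (integrable_const _)) (ae_of_all _ fun x => ?_)
    have hb := abs_tiltExponent_le (P := P) h t n x
    set b := tiltExponent P h t n x with hbdef
    set c := centeredTrunc P h n x
    have hs : (t / √(n : ℝ)) ^ 2 = t ^ 2 / n := by
      rw [div_pow, Real.sq_sqrt hn'.le]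
    have hbe : b / 2 = t / √(n : ℝ) / 2 * c - t ^ 2 * v / (4 * n) := by
      rw [hbdef, tiltExponent]; simp only [c, v]; field_simp; ring
    have hexp : |Real.exp (b / 2) - 1 - b / 2| ≤ tiltBound P h t n * |b| := by
      have hb1 : |b / 2| ≤ 1 := by
        rw [abs_div, abs_two]; linarith [abs_nonneg b]
      refine (Real.abs_exp_sub_one_sub_id_le hb1).trans ?_
      rw [div_pow, ← sq_abs]
      nlinarith [abs_nonneg b]
    have hexp2 : (Real.exp (b / 2) - 1 - b / 2) ^ 2 ≤ tiltBound P h t n ^ 2 * b ^ 2 := by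
      rw [← sq_abs, ← sq_abs b, ← mul_pow]
      gcongr
    have hmid : (t / √(n : ℝ) / 2 * (c - h x)) ^ 2 = t ^ 2 / (4 * n) * (c - h x) ^ 2 := by
      rw [mul_pow, div_pow, hs]; field_simp; ring
    have hsplit : Real.exp (b / 2) - (1 + t / √(n : ℝ) / 2 * h x) =
        (Real.exp (b / 2) - 1 - b / 2) + t / √(n : ℝ) / 2 * (c - h x) -
          t ^ 2 * v / (4 * n) := by
      rw [hbe]; ring
    simp only
    rw [hsplit]
    set X := Real.exp (b / 2) - 1 - b / 2
    set Y := t / √(n : ℝ) / 2 * (c - h x)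
    set Z := t ^ 2 * v / (4 * n)
    -- This is `(X + Y - Z)² ≤ 3(X² + Y² + Z²)` for the Taylor remainder, the truncation error and
    -- the drift; it explains the factors `3`.
    nlinarith [sq_nonneg (X - Y), sq_nonneg (X + Z), sq_nonneg (Y + Z)]
  refine (mul_le_mul_of_nonneg_left key hn'.le).trans (le_of_eq ?_)
  rw [integral_add j12 (integrable_const _), integral_add j1 j2, integral_const_mul,
    integral_const_mul]
  simp only [integral_const, probReal_univ, smul_eq_mul, one_mul]
  field_simp

end Truncation

/-! ### The score, its limit law and local asymptotic normality -/

section Score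

variable {Ω : Type*} [MeasurableSpace Ω]

instance (P : ProbabilityMeasure Ω) (n : ℕ) : IsProbabilityMeasure (iidLaw P n) := by
  unfold iidLaw; infer_instance

lemma measurable_normedSum {η : Ω → ℝ} (hη : Measurable η) (n : ℕ) :
    Measurable (normedSum η n) := by
  unfold normedSum; fun_prop

lemma integral_comp_measurePreserving {α β : Type*} [MeasurableSpace α] [MeasurableSpace β]
    {μ : Measure α} {ν : Measure β} {f : α → β} (hf : MeasurePreserving f μ ν) {g : β → ℝ}
    (hg : AEStronglyMeasurable g ν) : ∫ x, g (f x) ∂μ = ∫ y, g y ∂ν := by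
  rw [← hf.map_eq] at hg ⊢
  rw [integral_map hf.measurable.aemeasurable hg]

/-- The tail of a normed sum of centered variables, by Chebyshev's inequality. -/
lemma iidLaw_normedSum_ge_le (P : ProbabilityMeasure Ω) {η : Ω → ℝ}
    (hη : MemLp η 2 (P : Measure Ω)) (h0 : ∫ x, η x ∂(P : Measure Ω) = 0)
    {ε : ℝ} (hε : 0 < ε) (n : ℕ) :
    (iidLaw P n).real {x | ε ≤ |normedSum η n x|} ≤ (∫ x, η x ^ 2 ∂(P : Measure Ω)) / ε ^ 2 := by
  have hv : 0 ≤ ∫ x, η x ^ 2 ∂(P : Measure Ω) := integral_nonneg fun x => sq_nonneg _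
  have hm : ∀ i : Fin n, MemLp (fun x : Fin n → Ω => η (x i)) 2 (iidLaw P n) := fun i =>
    hη.comp_measurePreserving (measurePreserving_eval (fun _ : Fin n => (P : Measure Ω)) i)
  have hsum : MemLp (fun x : Fin n → Ω => ∑ i, η (x i)) 2 (iidLaw P n) :=
    memLp_finsetSum _ fun i _ => hm i
  have hX : MemLp (normedSum η n) 2 (iidLaw P n) := hsum.const_mul _
  have hmean : ∫ x, normedSum η n x ∂(iidLaw P n) = 0 := by
    unfold normedSum
    rw [integral_const_mul, integral_finsetSum _ fun i _ => (hm i).integrable (by norm_num)]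
    have : ∀ i : Fin n, ∫ x : Fin n → Ω, η (x i) ∂(iidLaw P n) = 0 := fun i => by
      rw [← h0]
      exact integral_comp_measurePreserving
        (measurePreserving_eval (fun _ : Fin n => (P : Measure Ω)) i) hη.aestronglyMeasurable
    simp [this]
  have hvar : Var[normedSum η n; iidLaw P n] ≤ ∫ x, η x ^ 2 ∂(P : Measure Ω) := by
    have h1 : Var[fun x : Fin n → Ω => ∑ i, η (x i); iidLaw P n] =
        n * ∫ x, η x ^ 2 ∂(P : Measure Ω) := by
      have := variance_sum_pi (ι := Fin n) (μ := fun _ => (P : Measure Ω)) (X := fun _ => η)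
        (fun _ => hη)
      rw [variance_of_integral_eq_zero hη.aestronglyMeasurable.aemeasurable h0] at this
      have e : (∑ i : Fin n, fun ω : Fin n → Ω => η (ω i)) = fun x => ∑ i, η (x i) := by
        ext x; simp
      rw [e] at this
      simpa [iidLaw] using this
    unfold normedSum
    rw [variance_const_mul, h1, inv_pow, Real.sq_sqrt (Nat.cast_nonneg n)]
    rcases n.eq_zero_or_pos with rfl | hn
    · simpa using hv
    · rw [inv_mul_cancel_left₀ (by positivity)]
  have h := meas_ge_le_variance_div_sq hX hε
  rw [hmean] at h
  simp only [sub_zero] at h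
  exact (ENNReal.toReal_le_of_le_ofReal (div_nonneg (variance_nonneg _ _) (sq_nonneg _)) h).trans
    (by gcongr)

/-- The normed sum of the truncated centered tangent. -/
def localScore (P : ProbabilityMeasure Ω) (h : Ω → ℝ) (n : ℕ) : (Fin n → Ω) → ℝ :=
  normedSum (centeredTrunc (P : Measure Ω) h n) n

variable {P : ProbabilityMeasure Ω} {h : Ω → ℝ}

lemma measurable_localScore (hh : Measurable h) (n : ℕ) : Measurable (localScore P h n) :=
  measurable_normedSum (measurable_centeredTrunc hh n) n

lemma isLittleOProb_localScore_sub (hh : Measurable h) (hh2 : MemLp h 2 (P : Measure Ω))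
    (h0 : ∫ x, h x ∂(P : Measure Ω) = 0) :
    IsLittleOProb P fun n x => localScore P h n x - normedSum h n x := by
  intro ε hε
  have hlim := (tendsto_integral_centeredTrunc_sub_sq hh hh2 h0).div_const (ε ^ 2)
  rw [zero_div] at hlim
  refine squeeze_zero (fun n => measureReal_nonneg) (fun n => ?_) hlim
  have e : ∀ x : Fin n → Ω, localScore P h n x - normedSum h n x =
      normedSum (fun y => centeredTrunc (P : Measure Ω) h n y - h y) n x := fun x => by
    simp only [localScore, normedSum, Finset.sum_sub_distrib]; ring
  simp_rw [e]
  refine iidLaw_normedSum_ge_le P ((memLp_centeredTrunc hh n 2).sub hh2) ?_ hε n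
  change ∫ x, (centeredTrunc (P : Measure Ω) h n x - h x) ∂(P : Measure Ω) = 0
  rw [integral_sub ((memLp_centeredTrunc hh n 1).integrable le_rfl)
    (hh2.integrable (by norm_num)), integral_centeredTrunc hh, h0, sub_zero]

/-- Exponents add up and the drifts `t²v/(2n)` sum to `t²v/2`. This exactness is the reason for
tilting: the likelihood ratio is a function of the score alone, with no remainder. -/
lemma prod_exp_tiltExponent (P : ProbabilityMeasure Ω) (h : Ω → ℝ) (t : ℝ) {n : ℕ} (hn : 0 < n)
    (x : Fin n → Ω) :
    ∏ i, Real.exp (tiltExponent (P : Measure Ω) h t n (x i)) =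
      Real.exp (t * localScore P h n x - t ^ 2 * (∫ y, h y ^ 2 ∂(P : Measure Ω)) / 2) := by
  have hn' : (0 : ℝ) < n := by exact_mod_cast hn
  rw [← Real.exp_sum]
  congr 1
  simp only [tiltExponent, localScore, normedSum, Finset.sum_sub_distrib, ← Finset.mul_sum,
    Finset.sum_const, Finset.card_univ, Fintype.card_fin, nsmul_eq_mul]
  field_simp

lemma integrable_exp_localScore (hh : Measurable h) (t : ℝ) (n : ℕ) :
    Integrable (fun x => Real.exp (t * localScore P h n x)) (iidLaw P n) := by
  refine Integrable.of_bound
    ((measurable_localScore hh n).const_mul t).exp.aestronglyMeasurable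
    (Real.exp (|t| * ((√(n : ℝ))⁻¹ * ∑ _ : Fin n, 2 * √√(n : ℝ)))) (ae_of_all _ fun x => ?_)
  rw [Real.norm_eq_abs, Real.abs_exp, Real.exp_le_exp]
  refine (le_abs_self _).trans ?_
  rw [abs_mul, localScore, normedSum, abs_mul, abs_of_nonneg (by positivity : 0 ≤ (√(n : ℝ))⁻¹)]
  gcongr
  exact (Finset.abs_sum_le_sum_abs _ _).trans
    (Finset.sum_le_sum fun i _ => abs_centeredTrunc_le h n _)

/-- Up to the factor `exp(t²v/2)`, the moment generating function is the total mass of the product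
of tilts, the `n`-th power of `1 + o(1/n)`. -/
lemma tendsto_integral_exp_localScore (hh : Measurable h) (hh2 : MemLp h 2 (P : Measure Ω))
    (h0 : ∫ x, h x ∂(P : Measure Ω) = 0) (t : ℝ) :
    Tendsto (fun n => ∫ x, Real.exp (t * localScore P h n x) ∂(iidLaw P n)) atTop
      (𝓝 (Real.exp (t ^ 2 * (∫ x, h x ^ 2 ∂(P : Measure Ω)) / 2))) := by
  have h1 := Real.tendsto_one_add_pow_exp_of_tendsto
    (tendsto_mul_integral_exp_tiltExponent hh hh2 h0 t)
  have h2 := h1.const_mul (Real.exp (t ^ 2 * (∫ x, h x ^ 2 ∂(P : Measure Ω)) / 2))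
  rw [Real.exp_zero, mul_one] at h2
  refine h2.congr' ?_
  filter_upwards [eventually_gt_atTop 0] with n hn
  rw [add_sub_cancel, ← integral_prod_pow, ← integral_const_mul]
  refine integral_congr_ae (ae_of_all _ fun x => ?_)
  simp only
  rw [prod_exp_tiltExponent P h t hn, ← Real.exp_add]
  congr 1; ring

lemma tendsto_div_sqrt_nhdsGT {t : ℝ} (ht : 0 < t) :
    Tendsto (fun n : ℕ => t / √(n : ℝ)) atTop (𝓝[>] 0) := by
  refine tendsto_nhdsWithin_iff.2 ⟨?_, ?_⟩
  · exact tendsto_const_nhds.div_atTop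
      (Real.tendsto_sqrt_atTop.comp tendsto_natCast_atTop_atTop)
  · filter_upwards [eventually_gt_atTop 0] with n hn
    have hn' : (0 : ℝ) < n := by exact_mod_cast hn
    exact div_pos ht (Real.sqrt_pos.2 hn')

/-- Local asymptotic normality of a tangent path. -/
lemma IsTangentPath.tendsto_iidLaw_sub {𝓜 : Set (ProbabilityMeasure Ω)}
    {g : Lp ℝ 2 (P : Measure Ω)} {Q : ℝ → ProbabilityMeasure Ω} (hQ : IsTangentPath 𝓜 P g Q)
    {t : ℝ} (ht : 0 < t) {A : (n : ℕ) → Set (Fin n → Ω)} (hA : ∀ n, MeasurableSet (A n)) :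
    Tendsto (fun n : ℕ => (iidLaw (Q (t / √(n : ℝ))) n).real (A n) -
      ∫ x in A n, Real.exp (t * localScore P g n x -
        t ^ 2 * (∫ y, g y ^ 2 ∂(P : Measure Ω)) / 2) ∂(iidLaw P n)) atTop (𝓝 0) := by
  have hg : Measurable g := (Lp.stronglyMeasurable g).measurable
  have hg2 : MemLp g 2 (P : Measure Ω) := Lp.memLp g
  have e : ∀ y : ℝ, Real.exp (y / 2) ^ 2 = Real.exp y := fun y => by
    rw [← Real.exp_nat_mul]; congr 1; push_cast; ring
  have h := TangentConeInference.tendsto_iidLaw_sub (P := P) (Q := fun n : ℕ => Q (t / √(n : ℝ)))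
    (g := g) (ρ := fun n x => Real.exp (tiltExponent (P : Measure Ω) g t n x / 2)) hg hg2
    (fun n => ((measurable_tiltExponent hg t n).div_const 2).exp)
    (fun n => by
      rw [memLp_two_iff_integrable_sq
        ((measurable_tiltExponent hg t n).div_const 2).exp.aestronglyMeasurable]
      simp_rw [e]
      exact integrable_comp_tiltExponent hg t n Real.continuous_exp)
    ht (hQ.root_diff.comp (tendsto_div_sqrt_nhdsGT ht))
    (by simp_rw [e]; exact tendsto_mul_integral_exp_tiltExponent hg hg2 hQ.centered t)
    (tendsto_mul_integral_root_sub_sq hg hg2 hQ.centered t) hA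
  refine h.congr' ?_
  filter_upwards [eventually_gt_atTop 0] with n hn
  simp_rw [e]
  congr 2
  ext x
  exact prod_exp_tiltExponent P g t hn x

/-- The central limit theorem for the normed sums. -/
lemma tendstoInDistribution_localScore (hh : Measurable h) (hh2 : MemLp h 2 (P : Measure Ω))
    (h0 : ∫ x, h x ∂(P : Measure Ω) = 0) :
    TendstoInDistribution (fun n => localScore P h n) atTop id (fun n => iidLaw P n)
      (gaussianReal 0 (∫ x, h x ^ 2 ∂(P : Measure Ω)).toNNReal) := by
  -- The infinite product carries all sample sizes at once: restriction to the first `n` coordinates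
  -- has law `P^n`. The central limit theorem is applied there and transported back.
  set Pinf : Measure (ℕ → Ω) := Measure.infinitePi fun _ => (P : Measure Ω)
  set r : (n : ℕ) → (ℕ → Ω) → (Fin n → Ω) := fun n ω i => ω i
  have mr : ∀ n, Measurable (r n) := fun n => by fun_prop
  have hr : ∀ n, Pinf.map (r n) = iidLaw P n := fun n => by
    have := Measure.map_infinitePi_infinitePi_of_inj (P := fun _ : ℕ => (P : Measure Ω))
      (f := fun i : Fin n => (i : ℕ)) Fin.val_injective
    rw [Measure.infinitePi_eq_pi (fun _ : Fin n => (P : Measure Ω))] at this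
    exact this
  have hmp : ∀ i : ℕ, MeasurePreserving (fun ω : ℕ → Ω => ω i) Pinf (P : Measure Ω) := fun i =>
    measurePreserving_eval_infinitePi _ i
  have hvar : Var[fun ω : ℕ → Ω => h (ω 0); Pinf] = ∫ x, h x ^ 2 ∂(P : Measure Ω) := by
    have := (hmp 0).variance_fun_comp (f := h) hh.aemeasurable
    rw [this, variance_of_integral_eq_zero hh.aemeasurable h0]
  have hmean : ∫ ω, h (ω 0) ∂Pinf = 0 := by
    rw [← h0]
    exact integral_comp_measurePreserving (hmp 0) hh.aestronglyMeasurable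
  have clt := tendstoInDistribution_inv_sqrt_mul_sum_sub (P := Pinf)
    (X := fun (i : ℕ) (ω : ℕ → Ω) => h (ω i))
    (P' := gaussianReal 0 (∫ x, h x ^ 2 ∂(P : Measure Ω)).toNNReal) (Y := id)
    (by rw [hvar]; exact HasLaw.id)
    (hh2.comp_measurePreserving (hmp 0))
    (iIndepFun_infinitePi fun _ => hh)
    (fun i => ⟨(hh.comp (measurable_pi_apply i)).aemeasurable,
      (hh.comp (measurable_pi_apply 0)).aemeasurable, by
        have : ∀ j : ℕ, Pinf.map (fun ω => h (ω j)) = (P : Measure Ω).map h := fun j => by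
          rw [← (hmp j).map_eq, Measure.map_map hh (hmp j).measurable]; rfl
        rw [this, this]⟩)
  have clt2 : TendstoInDistribution (fun n => localScore P h n ∘ r n) atTop id (fun _ => Pinf)
      (gaussianReal 0 (∫ x, h x ^ 2 ∂(P : Measure Ω)).toNNReal) := by
    refine tendstoInDistribution_of_tendstoInMeasure_sub _ _ clt ?_
      fun n => ((measurable_localScore hh n).comp (mr n)).aemeasurable
    rw [tendstoInMeasure_iff_measureReal_norm]
    intro ε hε
    refine (isLittleOProb_localScore_sub hh hh2 h0 ε hε).congr fun n => ?_
    have hset : MeasurableSet {x | ε ≤ |localScore P h n x - normedSum h n x|} :=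
      measurableSet_le measurable_const
        ((measurable_localScore hh n).sub (measurable_normedSum hh n)).abs
    rw [← hr n, map_measureReal_apply (mr n) hset]
    congr 1
    ext ω
    simp only [Set.mem_preimage, Set.mem_ofPred_eq, Pi.sub_apply, Pi.zero_apply, sub_zero,
      Function.comp, Real.norm_eq_abs, normedSum, r]
    rw [hmean, mul_zero, sub_zero, Finset.sum_range]
  refine ⟨fun n => (measurable_localScore hh n).aemeasurable, aemeasurable_id, ?_⟩
  refine clt2.tendsto.congr fun n => ?_
  apply Subtype.ext
  simp only
  rw [← Measure.map_map (measurable_localScore hh n) (mr n), hr n]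

end Score

/-! ### The normal distribution and its shifts -/

section Gaussian

lemma Phi_eq_real_Iic (u : ℝ) : Phi u = (gaussianReal 0 1).real (Set.Iic u) :=
  cdf_eq_real _ _

lemma Phi_eq_real_Iio (u : ℝ) : Phi u = (gaussianReal 0 1).real (Set.Iio u) := by
  have := nullSingletonClass_gaussianReal (μ := 0) (v := 1) one_ne_zero
  rw [Phi_eq_real_Iic, measureReal_congr Iio_ae_eq_Iic]

lemma continuous_Phi : Continuous Phi := by
  have := nullSingletonClass_gaussianReal (μ := 0) (v := 1) one_ne_zero
  rw [continuous_iff_continuousAt]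
  intro u
  change ContinuousAt (cdf (gaussianReal 0 1)) u
  rw [(monotone_cdf (gaussianReal 0 1)).continuousAt_iff_leftLim_eq_rightLim,
    StieltjesFunction.rightLim_eq]
  -- The jump at `u` is the mass of the atom `{u}`, which is zero.
  have h1 := (cdf (gaussianReal 0 1)).measure_singleton u
  rw [measure_cdf, measure_singleton] at h1
  have h2 := ENNReal.ofReal_eq_zero.1 h1.symm
  exact le_antisymm ((monotone_cdf (gaussianReal 0 1)).leftLim_le le_rfl) (by linarith)

lemma Phi_neg (u : ℝ) : Phi (-u) = 1 - Phi u := by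
  have h1 : (gaussianReal 0 1).real (Set.Iio (-u)) = (gaussianReal 0 1).real (Set.Ioi u) := by
    have h := gaussianReal_map_neg (μ := 0) (v := 1)
    rw [neg_zero] at h
    conv_lhs => rw [← h]
    rw [map_measureReal_apply measurable_neg measurableSet_Iio]
    congr 1
    ext x
    simp
  rw [Phi_eq_real_Iio, h1, Phi_eq_real_Iic, ← Set.compl_Iic, probReal_compl_eq_one_sub
    measurableSet_Iic]

lemma Phi_zero : Phi 0 = 1 / 2 := by
  have := Phi_neg 0
  rw [neg_zero] at this
  linarith

lemma gaussianReal_real_Iio {v : ℝ} (hv : 0 < v) (m c : ℝ) :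
    (gaussianReal m v.toNNReal).real (Set.Iio c) = Phi ((c - m) / √v) := by
  have hs : 0 < √v := Real.sqrt_pos.2 hv
  have h1 := gaussianReal_map_const_mul (μ := 0) (v := 1) (√v)
  have h2 := gaussianReal_map_add_const (μ := 0) (v := v.toNNReal) m
  have h3 : gaussianReal (√v * 0) (.mk (√v ^ 2) (sq_nonneg _) * 1) =
      gaussianReal 0 v.toNNReal := by
    congr 1
    · simp
    · ext; simp [Real.sq_sqrt hv.le, hv.le]
  rw [h3] at h1
  rw [zero_add] at h2
  rw [← h2, ← h1, Phi_eq_real_Iio, Measure.map_map (by fun_prop) (by fun_prop),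
    map_measureReal_apply (by fun_prop) measurableSet_Iio]
  congr 1
  ext x
  simp only [Set.mem_preimage, Function.comp, Set.mem_Iio]
  rw [lt_div_iff₀ hs, lt_sub_iff_add_lt, mul_comm]

/-- The density of `N(tv, v)` with respect to `N(0, v)`. -/
def shiftDensity (v t x : ℝ) : ℝ := Real.exp (t * x - t ^ 2 * v / 2)

lemma shiftDensity_pos (v t x : ℝ) : 0 < shiftDensity v t x := Real.exp_pos _

@[fun_prop]
lemma continuous_shiftDensity (v t : ℝ) : Continuous (shiftDensity v t) := by
  unfold shiftDensity; fun_prop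

lemma shiftDensity_mul (v s t x : ℝ) :
    shiftDensity v s x * shiftDensity v t x =
      Real.exp (-(s ^ 2 + t ^ 2) * v / 2) * Real.exp ((s + t) * x) := by
  unfold shiftDensity
  rw [← Real.exp_add, ← Real.exp_add]
  congr 1; ring

lemma shiftDensity_eq (v t x : ℝ) :
    shiftDensity v t x = Real.exp (-(t ^ 2 * v) / 2) * Real.exp (t * x) := by
  unfold shiftDensity
  rw [← Real.exp_add]
  congr 1; ring

lemma setIntegral_shiftDensity_gaussianReal {v : ℝ} (hv : 0 < v) (t c : ℝ) :
    ∫ x in Set.Iio c, shiftDensity v t x ∂(gaussianReal 0 v.toNNReal) =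
      Phi ((c - t * v) / √v) := by
  have hv0 : v.toNNReal ≠ 0 := by simpa using hv
  rw [← gaussianReal_real_Iio hv, measureReal_def, gaussianReal_apply_eq_integral _ hv0,
    ENNReal.toReal_ofReal (integral_nonneg fun x => gaussianPDFReal_nonneg _ _ x),
    ← integral_indicator measurableSet_Iio, ← integral_indicator measurableSet_Iio,
    integral_gaussianReal_eq_integral_smul hv0]
  congr 1
  ext x
  by_cases hx : x ∈ Set.Iio c
  · rw [Set.indicator_of_mem hx, Set.indicator_of_mem hx, gaussianPDFReal_def,
      gaussianPDFReal_def, smul_eq_mul, shiftDensity, mul_assoc, ← Real.exp_add,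
      Real.coe_toNNReal _ hv.le]
    congr 2
    field_simp
    ring
  · rw [Set.indicator_of_notMem hx, Set.indicator_of_notMem hx, smul_zero]

end Gaussian

/-! ### Upper limits in terms of eventual bounds -/

section Limsup

lemma limsup_le_iff_forall_eventually_le {u : ℕ → ℝ} {a : ℝ} (h0 : ∀ n, 0 ≤ u n)
    (h1 : ∀ n, u n ≤ 1) :
    limsup u atTop ≤ a ↔ ∀ ε : ℝ, 0 < ε → ∀ᶠ n in atTop, u n ≤ a + ε := by
  have hco : IsCoboundedUnder (· ≤ ·) atTop u :=
    (isBoundedUnder_of ⟨0, h0⟩ : IsBoundedUnder (· ≥ ·) atTop u).isCoboundedUnder_le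
  have hb : IsBoundedUnder (· ≤ ·) atTop u := isBoundedUnder_of ⟨1, h1⟩
  refine ⟨fun h ε hε => ?_, fun h => le_of_forall_pos_le_add fun ε hε => ?_⟩
  · exact (eventually_lt_of_limsup_lt (lt_of_le_of_lt h (lt_add_of_pos_right a hε)) hb).mono
      fun n hn => hn.le
  · exact limsup_le_of_le hco (h ε hε)

lemma tendsto_of_forall_eventually {u : ℕ → ℝ} {a : ℝ}
    (h1 : ∀ ε : ℝ, 0 < ε → ∀ᶠ n in atTop, u n ≤ a + ε)
    (h2 : ∀ ε : ℝ, 0 < ε → ∀ᶠ n in atTop, a - ε ≤ u n) : Tendsto u atTop (𝓝 a) := by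
  rw [Metric.tendsto_atTop']
  intro ε hε
  obtain ⟨N, hN⟩ :=
    ((h1 (ε / 2) (half_pos hε)).and (h2 (ε / 2) (half_pos hε))).exists_forall_of_atTop
  refine ⟨N, fun n hn => ?_⟩
  rw [Real.dist_eq, abs_lt]
  have := hN n hn.le
  constructor <;> linarith

end Limsup

/-! ### Asymptotic Neyman–Pearson theory for the Gaussian shift -/

section GaussianShift

/-- For `t > 0` the density is increasing, so on `{Y < a}` it equals its minimum with its value at
`a`. That minimum is bounded and continuous, so convergence in distribution applies to it although
the density is unbounded. -/
lemma setIntegral_lt_shiftDensity {F : Type*} [MeasurableSpace F] {ν : Measure F}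
    [IsProbabilityMeasure ν] {Y : F → ℝ} (hY : Measurable Y) {v t : ℝ} (ht : 0 < t) (a : ℝ) :
    ∫ x in {x | Y x < a}, shiftDensity v t (Y x) ∂ν =
      ∫ x, min (shiftDensity v t (Y x)) (shiftDensity v t a) ∂ν -
        shiftDensity v t a * (1 - ν.real {x | Y x < a}) := by
  have hB : MeasurableSet {x | Y x < a} := measurableSet_lt hY measurable_const
  have hmono : ∀ x y, x ≤ y → shiftDensity v t x ≤ shiftDensity v t y := fun x y hxy => by
    unfold shiftDensity; gcongr
  have hi : Integrable (fun x => min (shiftDensity v t (Y x)) (shiftDensity v t a)) ν := by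
    refine Integrable.of_bound (((continuous_shiftDensity v t).measurable.comp hY).min
      measurable_const).aestronglyMeasurable (shiftDensity v t a) (ae_of_all _ fun x => ?_)
    rw [Real.norm_eq_abs, abs_of_nonneg (le_min (shiftDensity_pos _ _ _).le
      (shiftDensity_pos _ _ _).le)]
    exact min_le_right _ _
  rw [← integral_add_compl hB hi,
    setIntegral_congr_fun hB (g := fun x => shiftDensity v t (Y x))
      (fun x hx => min_eq_left (hmono _ _ (le_of_lt hx))),
    setIntegral_congr_fun hB.compl (g := fun _ => shiftDensity v t a)
      (fun x hx => min_eq_right (hmono _ _ (not_lt.1 hx))),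
    setIntegral_const, probReal_compl_eq_one_sub hB, smul_eq_mul]
  ring

/-- The Neyman–Pearson identity for the test `A` against the threshold test `{Y < t v}`. -/
lemma neymanPearson_identity {F : Type*} [MeasurableSpace F] {ν : Measure F}
    [IsProbabilityMeasure ν] {Y : F → ℝ} (hY : Measurable Y) {v t : ℝ} (ht : 0 < t)
    (hi : Integrable (fun x => shiftDensity v t (Y x)) ν) {A : Set F} (hA : MeasurableSet A) :
    ν.real A + ∫ x in symmDiff A {x | Y x < t * v}, |1 - Real.exp (t * (Y x - t * v))| ∂ν =
      ν.real {x | Y x < t * v} + Real.exp (-(t ^ 2 * v) / 2) *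
        (∫ x in A, shiftDensity v t (Y x) ∂ν -
          ∫ x in {x | Y x < t * v}, shiftDensity v t (Y x) ∂ν) := by
  have hB : MeasurableSet {x | Y x < t * v} := measurableSet_lt hY measurable_const
  have hf : ∀ x, 1 - Real.exp (t * (Y x - t * v)) =
      1 - Real.exp (-(t ^ 2 * v) / 2) * shiftDensity v t (Y x) := fun x => by
    rw [shiftDensity, ← Real.exp_add]; congr 2; ring
  have If : Integrable (fun x => 1 - Real.exp (t * (Y x - t * v))) ν := by
    simp_rw [hf]; exact (integrable_const _).sub (hi.const_mul _)
  have hset : ∀ C : Set F, MeasurableSet C → ∫ x in C, (1 - Real.exp (t * (Y x - t * v))) ∂ν =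
      ν.real C - Real.exp (-(t ^ 2 * v) / 2) * ∫ x in C, shiftDensity v t (Y x) ∂ν := by
    intro C hC
    simp_rw [hf]
    rw [integral_sub (integrable_const _) (hi.const_mul _).restrict, integral_const_mul,
      setIntegral_const, smul_eq_mul, mul_one]
  -- The integrand is positive exactly on the threshold test. Any deviation of `A` from that test,
  -- in either direction, costs the absolute value of the integrand.
  have key : ∫ x in A, (1 - Real.exp (t * (Y x - t * v))) ∂ν +
      ∫ x in symmDiff A {x | Y x < t * v}, |1 - Real.exp (t * (Y x - t * v))| ∂ν =
      ∫ x in {x | Y x < t * v}, (1 - Real.exp (t * (Y x - t * v))) ∂ν := by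
    rw [← integral_indicator hA, ← integral_indicator (hA.symmDiff hB), ← integral_indicator hB,
      ← integral_add (If.indicator hA) (If.abs.indicator (hA.symmDiff hB))]
    refine integral_congr_ae (ae_of_all _ fun x => ?_)
    by_cases h1 : x ∈ A <;> by_cases h2 : Y x < t * v
    · simp [h1, h2, Set.mem_symmDiff]
    · have : 1 ≤ Real.exp (t * (Y x - t * v)) :=
        Real.one_le_exp (mul_nonneg ht.le (by linarith [not_lt.1 h2]))
      simp only [h1, h2, Set.mem_symmDiff, Set.indicator, Set.mem_ofPred_eq, if_true, not_true,
        not_false_eq_true, and_self, or_false, if_false]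
      rw [abs_of_nonpos (by linarith)]; ring
    · have : Real.exp (t * (Y x - t * v)) ≤ 1 :=
        Real.exp_le_one_iff.2 (mul_nonpos_of_nonneg_of_nonpos ht.le (by linarith))
      simp only [h1, h2, Set.mem_symmDiff, Set.indicator, Set.mem_ofPred_eq, if_true, not_true,
        not_false_eq_true, and_self, or_true, if_false]
      rw [abs_of_nonneg (by linarith)]; ring
    · simp [h1, h2, Set.mem_symmDiff]
  rw [hset A hA, hset _ hB] at key
  linarith

variable {E : ℕ → Type*} [∀ n, MeasurableSpace (E n)]

/-- The statistics `X n` are asymptotically `N(0, v)` under `μ n`, together with their moment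
generating functions. -/
structure GaussianShift (μ : (n : ℕ) → Measure (E n)) [∀ n, IsProbabilityMeasure (μ n)]
    (X : (n : ℕ) → E n → ℝ) (v : ℝ) : Prop where
  pos : 0 < v
  measurable : ∀ n, Measurable (X n)
  integrable_exp : ∀ t n, Integrable (fun x => Real.exp (t * X n x)) (μ n)
  tendsto_exp : ∀ t, Tendsto (fun n => ∫ x, Real.exp (t * X n x) ∂(μ n)) atTop
    (𝓝 (Real.exp (t ^ 2 * v / 2)))
  law : TendstoInDistribution X atTop id μ (gaussianReal 0 v.toNNReal)

namespace GaussianShift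

variable {μ : (n : ℕ) → Measure (E n)} [∀ n, IsProbabilityMeasure (μ n)]
  {X : (n : ℕ) → E n → ℝ} {v : ℝ}

lemma integrable_shift (H : GaussianShift μ X v) (t : ℝ) (n : ℕ) :
    Integrable (fun x => shiftDensity v t (X n x)) (μ n) := by
  simp_rw [shiftDensity_eq]
  exact (H.integrable_exp t n).const_mul _

lemma integrable_shift_mul (H : GaussianShift μ X v) (s t : ℝ) (n : ℕ) :
    Integrable (fun x => shiftDensity v s (X n x) * shiftDensity v t (X n x)) (μ n) := by
  simp_rw [shiftDensity_mul]
  exact (H.integrable_exp _ n).const_mul _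

lemma measurable_shift (H : GaussianShift μ X v) (t : ℝ) (n : ℕ) :
    Measurable (fun x => shiftDensity v t (X n x)) :=
  (continuous_shiftDensity v t).measurable.comp (H.measurable n)

lemma memLp_shift (H : GaussianShift μ X v) (t : ℝ) (n : ℕ) :
    MemLp (fun x => shiftDensity v t (X n x)) 2 (μ n) := by
  rw [memLp_two_iff_integrable_sq (H.measurable_shift t n).aestronglyMeasurable]
  simp_rw [sq]
  exact H.integrable_shift_mul t t n

lemma tendsto_integral_shift_mul (H : GaussianShift μ X v) (s t : ℝ) :
    Tendsto (fun n => ∫ x, shiftDensity v s (X n x) * shiftDensity v t (X n x) ∂(μ n)) atTop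
      (𝓝 (Real.exp (s * t * v))) := by
  have h := (H.tendsto_exp (s + t)).const_mul (Real.exp (-(s ^ 2 + t ^ 2) * v / 2))
  rw [← Real.exp_add] at h
  have e : -(s ^ 2 + t ^ 2) * v / 2 + (s + t) ^ 2 * v / 2 = s * t * v := by ring
  rw [e] at h
  refine h.congr fun n => ?_
  simp_rw [shiftDensity_mul]
  rw [integral_const_mul]

/-- The shifted laws depend continuously on the shift, in total variation. -/
lemma exists_integral_abs_sub_le (H : GaussianShift μ X v) (t : ℝ) {ε : ℝ} (hε : 0 < ε) :
    ∃ δ : ℝ, 0 < δ ∧ ∀ s : ℝ, |s - t| < δ → ∀ᶠ n in atTop,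
      ∫ x, |shiftDensity v s (X n x) - shiftDensity v t (X n x)| ∂(μ n) ≤ ε := by
  -- `L s` is the limiting squared `L₂` distance of the two likelihood ratios. It is continuous and
  -- vanishes at `s = t`; Cauchy–Schwarz then bounds the `L₁` distance.
  set L : ℝ → ℝ := fun s => Real.exp (s * s * v) - 2 * Real.exp (s * t * v) + Real.exp (t * t * v)
  have hL : Tendsto L (𝓝 t) (𝓝 0) := by
    have : Continuous L := by fun_prop
    have h := this.tendsto t
    have e : L t = 0 := by simp only [L]; ring
    rwa [e] at h
  obtain ⟨δ, hδ, hδL⟩ := Metric.eventually_nhds_iff.1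
    (hL.eventually (eventually_lt_nhds (by positivity : (0 : ℝ) < ε ^ 2)))
  refine ⟨δ, hδ, fun s hs => ?_⟩
  have hlim : Tendsto (fun n => ∫ x, (shiftDensity v s (X n x) - shiftDensity v t (X n x)) ^ 2
      ∂(μ n)) atTop (𝓝 (L s)) := by
    refine (((H.tendsto_integral_shift_mul s s).sub
      ((H.tendsto_integral_shift_mul s t).const_mul 2)).add
      (H.tendsto_integral_shift_mul t t)).congr fun n => ?_
    have i1 := H.integrable_shift_mul s s n
    have i2 := (H.integrable_shift_mul s t n).const_mul 2
    have i12 : Integrable (fun x => shiftDensity v s (X n x) * shiftDensity v s (X n x) -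
      2 * (shiftDensity v s (X n x) * shiftDensity v t (X n x))) (μ n) := i1.sub i2
    rw [← integral_const_mul, ← integral_sub i1 i2,
      ← integral_add i12 (H.integrable_shift_mul t t n)]
    exact integral_congr_ae (ae_of_all _ fun x => by simp only; ring)
  filter_upwards [hlim.eventually (eventually_lt_nhds (hδL hs))] with n hn
  have hm : MemLp (fun x => shiftDensity v s (X n x) - shiftDensity v t (X n x)) 2 (μ n) :=
    (H.memLp_shift s n).sub (H.memLp_shift t n)
  have hcs := sq_integral_abs_mul_le hm (memLp_const (1 : ℝ))
  simp only [mul_one, one_pow, integral_const, probReal_univ, smul_eq_mul] at hcs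
  exact le_of_abs_le (abs_le_of_sq_le_sq (hcs.trans hn.le) hε.le)

lemma tendsto_integral_bounded (H : GaussianShift μ X v) {f : ℝ → ℝ} (hf : Continuous f) {C : ℝ}
    (hC : ∀ x, |f x| ≤ C) :
    Tendsto (fun n => ∫ x, f (X n x) ∂(μ n)) atTop
      (𝓝 (∫ x, f x ∂(gaussianReal 0 v.toNNReal))) := by
  have h := ProbabilityMeasure.tendsto_iff_forall_integral_tendsto.1 H.law.tendsto
    (BoundedContinuousFunction.ofNormedAddCommGroup f hf C hC)
  simp only [ProbabilityMeasure.coe_mk, BoundedContinuousFunction.coe_ofNormedAddCommGroup,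
    Measure.map_id] at h
  refine h.congr fun n => ?_
  rw [integral_map (H.measurable n).aemeasurable hf.aestronglyMeasurable]

lemma tendsto_real_lt (H : GaussianShift μ X v) (c : ℝ) :
    Tendsto (fun n => (μ n).real {x | X n x < c}) atTop (𝓝 (Phi (c / √v))) := by
  have hv0 : v.toNNReal ≠ 0 := by simpa using H.pos
  have := nullSingletonClass_gaussianReal (μ := 0) hv0
  have h := ProbabilityMeasure.tendsto_measure_of_null_frontier_of_tendsto' H.law.tendsto
    (E := Set.Iio c) (by
      simp only [ProbabilityMeasure.coe_mk, Measure.map_id]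
      rw [frontier_Iio, measure_singleton])
  simp only [ProbabilityMeasure.coe_mk, Measure.map_id] at h
  have h2 := (ENNReal.tendsto_toReal (measure_ne_top _ _)).comp h
  have e := gaussianReal_real_Iio H.pos 0 c
  rw [sub_zero] at e
  rw [← e]
  refine h2.congr fun n => ?_
  simp only [Function.comp, ← measureReal_def]
  rw [map_measureReal_apply (H.measurable n) measurableSet_Iio]
  rfl

/-- The threshold `tv` is the mean, hence the median, of the shifted normal law. -/
lemma tendsto_setIntegral_lt (H : GaussianShift μ X v) {t : ℝ} (ht : 0 < t) :
    Tendsto (fun n => ∫ x in {x | X n x < t * v}, shiftDensity v t (X n x) ∂(μ n)) atTop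
      (𝓝 (1 / 2)) := by
  have hlim := setIntegral_shiftDensity_gaussianReal H.pos t (t * v)
  rw [sub_self, zero_div, Phi_zero] at hlim
  have h0 := setIntegral_lt_shiftDensity (ν := gaussianReal 0 v.toNNReal) measurable_id (v := v)
    ht (t * v)
  have h1 := gaussianReal_real_Iio H.pos 0 (t * v)
  rw [sub_zero] at h1
  simp only [id] at h0
  change ∫ x in Set.Iio (t * v), _ ∂_ = _ - _ * (1 - (gaussianReal 0 v.toNNReal).real
    (Set.Iio (t * v))) at h0
  rw [hlim, h1] at h0
  rw [h0]
  simp_rw [fun n => setIntegral_lt_shiftDensity (ν := μ n) (H.measurable n) (v := v) ht (t * v)]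
  refine (H.tendsto_integral_bounded
    (f := fun x => min (shiftDensity v t x) (shiftDensity v t (t * v))) (by fun_prop)
    (C := shiftDensity v t (t * v)) fun x => ?_).sub
    (((H.tendsto_real_lt (t * v)).const_sub 1).const_mul _)
  rw [abs_of_nonneg (le_min (shiftDensity_pos _ _ _).le (shiftDensity_pos _ _ _).le)]
  exact min_le_right _ _

/-- Asymptotic Neyman–Pearson bound, with the deviation from the optimal test. -/
lemma eventually_add_setIntegral_le (H : GaussianShift μ X v) {t : ℝ} (ht : 0 < t)
    {A : (n : ℕ) → Set (E n)} (hA : ∀ n, MeasurableSet (A n))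
    (hmed : ∀ ε : ℝ, 0 < ε → ∀ᶠ n in atTop,
      ∫ x in A n, shiftDensity v t (X n x) ∂(μ n) ≤ 1 / 2 + ε) {ε : ℝ} (hε : 0 < ε) :
    ∀ᶠ n in atTop, (μ n).real (A n) + ∫ x in symmDiff (A n) {x | X n x < t * v},
      |1 - Real.exp (t * (X n x - t * v))| ∂(μ n) ≤ Phi (t * v / √v) + ε := by
  filter_upwards [hmed (ε / 3) (by positivity),
    (H.tendsto_real_lt (t * v)).eventually
      (eventually_le_nhds (by linarith : Phi (t * v / √v) < Phi (t * v / √v) + ε / 3)),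
    (H.tendsto_setIntegral_lt ht).eventually
      (eventually_ge_nhds (by linarith : (1 : ℝ) / 2 - ε / 3 < 1 / 2))] with n h1 h2 h3
  rw [neymanPearson_identity (H.measurable n) ht (H.integrable_shift t n) (hA n)]
  have hk : Real.exp (-(t ^ 2 * v) / 2) ≤ 1 := by
    rw [Real.exp_le_one_iff]
    have := H.pos
    have : 0 ≤ t ^ 2 * v := by positivity
    linarith
  have hk0 := Real.exp_pos (-(t ^ 2 * v) / 2)
  have : Real.exp (-(t ^ 2 * v) / 2) * (∫ x in A n, shiftDensity v t (X n x) ∂(μ n) -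
      ∫ x in {x | X n x < t * v}, shiftDensity v t (X n x) ∂(μ n)) ≤ 1 * (2 * ε / 3) :=
    (mul_le_mul_of_nonneg_left (by linarith) hk0.le).trans
      (mul_le_mul_of_nonneg_right hk (by positivity))
  linarith

/-- A test attaining the Neyman–Pearson bound is asymptotically the threshold test. -/
lemma tendsto_symmDiff (H : GaussianShift μ X v) {t : ℝ} (ht : 0 < t)
    {A : (n : ℕ) → Set (E n)} (hA : ∀ n, MeasurableSet (A n))
    (hmed : ∀ ε : ℝ, 0 < ε → ∀ᶠ n in atTop,
      ∫ x in A n, shiftDensity v t (X n x) ∂(μ n) ≤ 1 / 2 + ε)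
    (hlim : Tendsto (fun n => (μ n).real (A n)) atTop (𝓝 (Phi (t * v / √v)))) :
    Tendsto (fun n => (μ n).real (symmDiff (A n) {x | X n x < t * v})) atTop (𝓝 0) := by
  set a := t * v with ha
  have hB : ∀ n, MeasurableSet {x | X n x < a} := fun n =>
    measurableSet_lt (H.measurable n) measurable_const
  refine tendsto_of_forall_eventually (fun ε hε => ?_)
    fun ε hε => Eventually.of_forall fun n => by
      rw [zero_sub]; exact (neg_nonpos.2 hε.le).trans measureReal_nonneg
  -- The weight degenerates only at the threshold, so a band of half-width `δ` and limiting mass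
  -- below `ε/2` is set aside. Outside it the weight is at least `m`.
  have hc : Tendsto (fun δ : ℝ => Phi ((a + δ) / √v) - Phi ((a - δ) / √v)) (𝓝[>] 0) (𝓝 0) := by
    have : Continuous fun δ : ℝ => Phi ((a + δ) / √v) - Phi ((a - δ) / √v) :=
      (continuous_Phi.comp (by fun_prop)).sub (continuous_Phi.comp (by fun_prop))
    have h := this.tendsto 0
    simp only [add_zero, sub_zero, sub_self] at h
    exact h.mono_left nhdsWithin_le_nhds
  obtain ⟨δ, hδ, hδ0⟩ := ((hc.eventually (eventually_lt_nhds (half_pos hε))).and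
    self_mem_nhdsWithin).exists
  have hδ0 : 0 < δ := hδ0
  set m := 1 - Real.exp (-(t * δ)) with hm
  have hm0 : 0 < m := by
    rw [hm, sub_pos, Real.exp_lt_one_iff, neg_lt_zero]; positivity
  have hf : ∀ y : ℝ, y < a - δ ∨ a + δ ≤ y → m ≤ |1 - Real.exp (t * (y - a))| := by
    rintro y (hy | hy)
    · have h1 : Real.exp (t * (y - a)) ≤ Real.exp (-(t * δ)) := by
        rw [Real.exp_le_exp]; nlinarith
      exact (by linarith : m ≤ 1 - Real.exp (t * (y - a))).trans (le_abs_self _)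
    · have h1 : Real.exp (t * δ) ≤ Real.exp (t * (y - a)) := by
        rw [Real.exp_le_exp]; nlinarith
      have h2 : 1 ≤ Real.exp (t * δ) := Real.one_le_exp (by positivity)
      have h3 : Real.exp (t * δ) * Real.exp (-(t * δ)) = 1 := by
        rw [← Real.exp_add, add_neg_cancel, Real.exp_zero]
      have h4 := Real.exp_pos (-(t * δ))
      refine le_trans ?_ (neg_le_abs _)
      nlinarith
  have hgap : Tendsto (fun n => (μ n).real {x | X n x < a + δ} - (μ n).real {x | X n x < a - δ})
      atTop (𝓝 (Phi ((a + δ) / √v) - Phi ((a - δ) / √v))) :=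
    (H.tendsto_real_lt _).sub (H.tendsto_real_lt _)
  -- Two errors of `mε/4` bound the weighted symmetric difference by `mε/2`; dividing by `m` leaves
  -- `ε/2` outside the band.
  filter_upwards [hgap.eventually (eventually_lt_nhds hδ),
    H.eventually_add_setIntegral_le ht hA hmed (ε := m * ε / 4) (by positivity),
    hlim.eventually (eventually_ge_nhds
      (by linarith [mul_pos hm0 hε] : Phi (a / √v) - m * ε / 4 < Phi (a / √v)))] with n h1 h2 h3
  set D := symmDiff (A n) {x | X n x < a} with hD
  have mD : MeasurableSet D := (hA n).symmDiff (hB n)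
  set G := {x | X n x < a + δ} \ {x | X n x < a - δ} with hG
  have mG : MeasurableSet G := (measurableSet_lt (H.measurable n) measurable_const).diff
    (measurableSet_lt (H.measurable n) measurable_const)
  have hGr : (μ n).real G =
      (μ n).real {x | X n x < a + δ} - (μ n).real {x | X n x < a - δ} :=
    measureReal_sdiff (fun x (hx : X n x < a - δ) => show X n x < a + δ by linarith)
      (measurableSet_lt (H.measurable n) measurable_const)
  have hint : Integrable (fun x => |1 - Real.exp (t * (X n x - a))|) (μ n) := by
    refine Integrable.abs ((integrable_const _).sub ?_)
    refine ((H.integrable_exp t n).const_mul (Real.exp (-(t * a)))).congr (ae_of_all _ fun x => ?_)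
    simp only
    rw [← Real.exp_add]; congr 1; ring
  have hlow : m * (μ n).real (D \ G) ≤ ∫ x in D, |1 - Real.exp (t * (X n x - a))| ∂(μ n) := by
    calc m * (μ n).real (D \ G) = ∫ x in D \ G, m ∂(μ n) := by
          rw [setIntegral_const, smul_eq_mul, mul_comm]
      _ ≤ ∫ x in D \ G, |1 - Real.exp (t * (X n x - a))| ∂(μ n) := by
          refine setIntegral_mono_on (integrable_const _).integrableOn hint.integrableOn
            (mD.diff mG) fun x hx => hf _ ?_
          by_contra hcon
          rw [not_or, not_lt, not_le] at hcon
          exact hx.2 ⟨hcon.2, not_lt.2 hcon.1⟩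
      _ ≤ _ := setIntegral_mono_set hint.integrableOn (ae_of_all _ fun x => abs_nonneg _)
          (LE.le.eventuallyLE Set.sdiff_subset)
  have hsub : (μ n).real D ≤ (μ n).real (D \ G) + (μ n).real G := by
    refine (measureReal_mono ?_).trans (measureReal_union_le _ _)
    rw [Set.sdiff_union_self]
    exact Set.subset_union_left
  have h5 : (μ n).real (D \ G) ≤ ε / 2 := by
    refine le_of_mul_le_mul_left ?_ hm0
    linarith
  linarith

end GaussianShift

end GaussianShift

/-! ### Level sets and positive parts -/

section PositivePart

variable {E : ℕ → Type*} [∀ n, MeasurableSpace (E n)]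
  {μ : (n : ℕ) → Measure (E n)} [∀ n, IsProbabilityMeasure (μ n)]
  {X D : (n : ℕ) → E n → ℝ} {v : ℝ}

namespace GaussianShift

/-- Median unbiasedness at the moving thresholds `c t n → t v` implies median unbiasedness at the
limiting thresholds. -/
lemma eventually_setIntegral_lt_le (H : GaussianShift μ X v) {c : ℝ → ℕ → ℝ}
    (hc : ∀ t, 0 < t → Tendsto (c t) atTop (𝓝 (t * v)))
    (hmed : ∀ t, 0 < t → ∀ ε : ℝ, 0 < ε → ∀ᶠ n in atTop,
      ∫ x in {x | D n x < c t n}, shiftDensity v t (X n x) ∂(μ n) ≤ 1 / 2 + ε)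
    {t : ℝ} (ht : 0 < t) {ε : ℝ} (hε : 0 < ε) :
    ∀ᶠ n in atTop, ∫ x in {x | D n x < t * v}, shiftDensity v t (X n x) ∂(μ n) ≤ 1 / 2 + ε := by
  obtain ⟨δ, hδ, hs⟩ := H.exists_integral_abs_sub_le t (half_pos hε)
  -- A slightly larger shift is used: its thresholds `c s n` tend to `sv > tv` and so eventually
  -- exceed `tv`, while the two shifted laws stay close in total variation.
  set s := t + δ / 2 with hsdef
  have hst : |s - t| < δ := by
    rw [hsdef, add_sub_cancel_left, abs_of_pos (half_pos hδ)]; linarith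
  have hs0 : 0 < s := by positivity
  have hlt : t * v < s * v := mul_lt_mul_of_pos_right (by linarith) H.pos
  filter_upwards [hs s hst, hmed s hs0 (ε / 2) (half_pos hε),
    (hc s hs0).eventually (eventually_ge_nhds hlt)] with n h1 h2 h3
  have hi : Integrable (fun x => |shiftDensity v s (X n x) - shiftDensity v t (X n x)|) (μ n) :=
    ((H.integrable_shift s n).sub (H.integrable_shift t n)).abs
  have hi2 : Integrable (fun x => shiftDensity v s (X n x) +
      |shiftDensity v s (X n x) - shiftDensity v t (X n x)|) (μ n) :=
    (H.integrable_shift s n).add hi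
  calc ∫ x in {x | D n x < t * v}, shiftDensity v t (X n x) ∂(μ n)
      ≤ ∫ x in {x | D n x < t * v}, (shiftDensity v s (X n x) +
          |shiftDensity v s (X n x) - shiftDensity v t (X n x)|) ∂(μ n) := by
        refine setIntegral_mono (H.integrable_shift t n).integrableOn hi2.integrableOn fun x => ?_
        simp only
        linarith [neg_le_abs (shiftDensity v s (X n x) - shiftDensity v t (X n x))]
    _ = ∫ x in {x | D n x < t * v}, shiftDensity v s (X n x) ∂(μ n) +
          ∫ x in {x | D n x < t * v},
            |shiftDensity v s (X n x) - shiftDensity v t (X n x)| ∂(μ n) :=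
        integral_add (H.integrable_shift s n).integrableOn hi.integrableOn
    _ ≤ ∫ x in {x | D n x < c s n}, shiftDensity v s (X n x) ∂(μ n) + ε / 2 := by
        refine add_le_add ?_ ((setIntegral_le_integral hi
          (ae_of_all _ fun x => abs_nonneg _)).trans h1)
        exact setIntegral_mono_set (H.integrable_shift s n).integrableOn
          (ae_of_all _ fun x => (shiftDensity_pos _ _ _).le)
          (LE.le.eventuallyLE fun x (hx : D n x < t * v) => hx.trans_le h3)
    _ ≤ 1 / 2 + ε := by linarith

/-- The asymptotic bound for the one-sided concentration of a median unbiased statistic. -/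
lemma eventually_real_lt_le (H : GaussianShift μ X v)
    (hmed : ∀ t, 0 < t → ∀ ε : ℝ, 0 < ε → ∀ᶠ n in atTop,
      ∫ x in {x | D n x < t * v}, shiftDensity v t (X n x) ∂(μ n) ≤ 1 / 2 + ε)
    (hD : ∀ n, Measurable (D n)) {c : ℝ} (hc : 0 < c) {ε : ℝ} (hε : 0 < ε) :
    ∀ᶠ n in atTop, (μ n).real {x | D n x < c} ≤ Phi (c / √v) + ε := by
  have ht : 0 < c / v := div_pos hc H.pos
  have e : c / v * v = c := div_mul_cancel₀ c H.pos.ne'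
  have h := H.eventually_add_setIntegral_le ht (A := fun n => {x | D n x < c})
    (fun n => measurableSet_lt (hD n) measurable_const)
    (fun ε hε => by have := hmed (c / v) ht ε hε; rwa [e] at this) hε
  rw [e] at h
  filter_upwards [h] with n hn
  exact (le_add_of_nonneg_right (integral_nonneg fun x => abs_nonneg _)).trans hn

lemma tendsto_Phi_div_atTop (hv : 0 < v) {ε : ℝ} (hε : 0 < ε) :
    Tendsto (fun N : ℕ => Phi (N * ε / √v)) atTop (𝓝 1) := by
  refine (tendsto_cdf_atTop (gaussianReal 0 1)).comp ?_
  exact (tendsto_natCast_atTop_atTop.atTop_mul_const hε).atTop_div_const (Real.sqrt_pos.2 hv)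

/-- Asymptotic equality of all level sets at positive levels implies asymptotic equality of the
positive parts. -/
lemma tendsto_real_posPart_sub (H : GaussianShift μ X v)
    (h : ∀ c : ℝ, 0 < c → Tendsto (fun n =>
      (μ n).real (symmDiff {x | D n x < c} {x | X n x < c})) atTop (𝓝 0))
    {ε : ℝ} (hε : 0 < ε) :
    Tendsto (fun n => (μ n).real {x | ε ≤ |max (D n x) 0 - max (X n x) 0|}) atTop (𝓝 0) := by
  refine tendsto_of_forall_eventually (fun η hη => ?_)
    fun η hη => Eventually.of_forall fun n => by
      rw [zero_sub]; exact (neg_nonpos.2 hη.le).trans measureReal_nonneg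
  -- Beyond `Nε` the variable `X n` has small mass; below it, finitely many grid levels of mesh `ε`
  -- suffice.
  obtain ⟨N, hN, hN0⟩ := (((tendsto_Phi_div_atTop H.pos hε).eventually
    (eventually_gt_nhds (by linarith : 1 - η / 2 < 1))).and (eventually_gt_atTop 0)).exists
  have hsum : Tendsto (fun n => ∑ j ∈ Finset.range N, (μ n).real
      (symmDiff {x | D n x < (j + 1) * ε} {x | X n x < (j + 1) * ε})) atTop (𝓝 0) := by
    have := tendsto_finsetSum (Finset.range N) fun j _ => h ((j + 1) * ε) (by positivity)
    simpa using this
  filter_upwards [hsum.eventually (eventually_lt_nhds (by positivity : 0 < η / 2)),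
    (H.tendsto_real_lt (N * ε)).eventually (eventually_gt_nhds hN)] with n h1 h2
  have hB : MeasurableSet {x | X n x < N * ε} := measurableSet_lt (H.measurable n) measurable_const
  have hsub : {x | ε ≤ |max (D n x) 0 - max (X n x) 0|} ⊆
      (⋃ j ∈ Finset.range N, symmDiff {x | D n x < (j + 1) * ε} {x | X n x < (j + 1) * ε}) ∪
        {x | X n x < N * ε}ᶜ := by
    intro x hx
    by_cases hXN : X n x < N * ε
    · left
      have hx : ε ≤ |max (D n x) 0 - max (X n x) 0| := hx
      set p := max (D n x) 0 with hp
      set q := max (X n x) 0 with hq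
      have hm0 : 0 ≤ min p q := le_min (le_max_right _ _) (le_max_right _ _)
      have hNε : (0 : ℝ) < N * ε := by positivity
      have hqN : q < N * ε := max_lt hXN hNε
      -- `j` is the grid cell of the smaller positive part. The larger one exceeds it by at least
      -- `ε`, so the level `(j + 1)ε` separates them; as that level is positive, it also separates
      -- `D n x` and `X n x`.
      set j := ⌊min p q / ε⌋₊ with hj
      have hj1 : (j : ℝ) * ε ≤ min p q :=
        (le_div_iff₀ hε).1 (Nat.floor_le (div_nonneg hm0 hε.le))
      have hj2 : min p q < (j + 1) * ε := (div_lt_iff₀ hε).1 (Nat.lt_floor_add_one _)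
      have hjN : j < N := by
        have : (j : ℝ) * ε < N * ε := hj1.trans_lt ((min_le_right _ _).trans_lt hqN)
        exact_mod_cast lt_of_mul_lt_mul_right this hε.le
      have hc0 : 0 < ((j : ℝ) + 1) * ε := by positivity
      simp only [Set.mem_iUnion, Finset.mem_range, exists_prop]
      refine ⟨j, hjN, ?_⟩
      rw [Set.mem_symmDiff]
      simp only [Set.mem_ofPred_eq, not_lt]
      rcases le_total p q with hpq | hpq
      · left
        rw [min_eq_left hpq] at hj1 hj2
        rw [abs_of_nonpos (by linarith)] at hx
        refine ⟨(le_max_left _ _).trans_lt hj2, ?_⟩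
        have : (j + 1) * ε ≤ q := by linarith
        exact (le_max_iff.1 this).resolve_right (by linarith)
      · right
        rw [min_eq_right hpq] at hj1 hj2
        rw [abs_of_nonneg (by linarith)] at hx
        refine ⟨(le_max_left _ _).trans_lt hj2, ?_⟩
        have : (j + 1) * ε ≤ p := by linarith
        exact (le_max_iff.1 this).resolve_right (by linarith)
    · right; exact hXN
  have h3 : (μ n).real {x | X n x < N * ε}ᶜ = 1 - (μ n).real {x | X n x < N * ε} :=
    probReal_compl_eq_one_sub hB
  have h4 := (measureReal_mono (μ := μ n) hsub).trans (measureReal_union_le _ _)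
  have h5 := measureReal_biUnion_finset_le (μ := μ n) (Finset.range N)
    fun j : ℕ => symmDiff {x | D n x < (j + 1) * ε} {x | X n x < (j + 1) * ε}
  rw [h3] at h4
  linarith

/-- A median unbiased statistic attaining the bound agrees with `X`, up to the negative parts. -/
lemma tendsto_real_posPart_sub_of_attains (H : GaussianShift μ X v)
    (hmed : ∀ t, 0 < t → ∀ ε : ℝ, 0 < ε → ∀ᶠ n in atTop,
      ∫ x in {x | D n x < t * v}, shiftDensity v t (X n x) ∂(μ n) ≤ 1 / 2 + ε)
    (hD : ∀ n, Measurable (D n))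
    (hatt : ∀ c : ℝ, 0 < c →
      Tendsto (fun n => (μ n).real {x | D n x < c}) atTop (𝓝 (Phi (c / √v))))
    {ε : ℝ} (hε : 0 < ε) :
    Tendsto (fun n => (μ n).real {x | ε ≤ |max (D n x) 0 - max (X n x) 0|}) atTop (𝓝 0) := by
  refine H.tendsto_real_posPart_sub (fun c hc => ?_) hε
  have ht : 0 < c / v := div_pos hc H.pos
  have e : c / v * v = c := div_mul_cancel₀ c H.pos.ne'
  have h := H.tendsto_symmDiff ht (A := fun n => {x | D n x < c})
    (fun n => measurableSet_lt (hD n) measurable_const)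
    (fun ε hε => by have := hmed (c / v) ht ε hε; rwa [e] at this)
    (by rw [e]; exact hatt c hc)
  rwa [e] at h

lemma tendsto_real_lt_of_posPart (H : GaussianShift μ X v)
    (hR : ∀ ε : ℝ, 0 < ε → Tendsto (fun n =>
      (μ n).real {x | ε ≤ |max (D n x) 0 - max (X n x) 0|}) atTop (𝓝 0))
    {c : ℝ} (hc : 0 < c) :
    Tendsto (fun n => (μ n).real {x | D n x < c}) atTop (𝓝 (Phi (c / √v))) := by
  have hcont : ∀ σ : ℝ, Tendsto (fun δ : ℝ => Phi ((c + σ * δ) / √v)) (𝓝[>] 0)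
      (𝓝 (Phi (c / √v))) := fun σ => by
    have : Continuous fun δ : ℝ => Phi ((c + σ * δ) / √v) := continuous_Phi.comp (by fun_prop)
    have h := this.tendsto 0
    simp only [mul_zero, add_zero] at h
    exact h.mono_left nhdsWithin_le_nhds
  refine tendsto_of_forall_eventually (fun ε hε => ?_) fun ε hε => ?_
  · obtain ⟨δ, h1, hδ⟩ := (((hcont 1).eventually (eventually_lt_nhds
      (by linarith : Phi (c / √v) < Phi (c / √v) + ε / 2))).and self_mem_nhdsWithin).exists
    have hδ : 0 < δ := hδ
    filter_upwards [(H.tendsto_real_lt _).eventually (eventually_lt_nhds h1),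
      (hR δ hδ).eventually (eventually_lt_nhds (half_pos hε))] with n h2 h3
    have hsub : {x | D n x < c} ⊆ {x | X n x < c + 1 * δ} ∪
        {x | δ ≤ |max (D n x) 0 - max (X n x) 0|} := by
      intro x (hx : D n x < c)
      by_cases hr : δ ≤ |max (D n x) 0 - max (X n x) 0|
      · right; exact hr
      · left
        have h4 := (abs_lt.1 (not_le.1 hr)).1
        have h5 : max (D n x) 0 < c := max_lt hx hc
        have h6 := le_max_left (X n x) 0
        show X n x < c + 1 * δ
        linarith
    have := (measureReal_mono (μ := μ n) hsub).trans (measureReal_union_le _ _)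
    linarith
  -- Here `δ < c` is needed as well: `c - δ` stays positive, so `X < c - δ` also bounds the positive
  -- part of `X`.
  · obtain ⟨δ, h1, hδ, hδc⟩ := (((hcont (-1)).eventually (eventually_gt_nhds
      (by linarith : Phi (c / √v) - ε / 2 < Phi (c / √v)))).and
      (Ioo_mem_nhdsGT hc)).exists
    filter_upwards [(H.tendsto_real_lt _).eventually (eventually_gt_nhds h1),
      (hR δ hδ).eventually (eventually_lt_nhds (half_pos hε))] with n h2 h3
    have hsub : {x | X n x < c + -1 * δ} ⊆ {x | D n x < c} ∪
        {x | δ ≤ |max (D n x) 0 - max (X n x) 0|} := by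
      intro x (hx : X n x < c + -1 * δ)
      by_cases hr : δ ≤ |max (D n x) 0 - max (X n x) 0|
      · right; exact hr
      · left
        have h4 := (abs_lt.1 (not_le.1 hr)).2
        have h5 : max (X n x) 0 < c - δ := max_lt (by linarith) (by linarith)
        have h6 := le_max_left (D n x) 0
        show D n x < c
        linarith
    have := (measureReal_mono (μ := μ n) hsub).trans (measureReal_union_le _ _)
    linarith

/-- Contiguity: the likelihood ratios have convergent second moments, so Cauchy–Schwarz makes
negligible events negligible under the shift. -/
lemma tendsto_setIntegral_zero (H : GaussianShift μ X v) (t : ℝ) {A : (n : ℕ) → Set (E n)}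
    (hA : ∀ n, MeasurableSet (A n)) (h : Tendsto (fun n => (μ n).real (A n)) atTop (𝓝 0)) :
    Tendsto (fun n => ∫ x in A n, shiftDensity v t (X n x) ∂(μ n)) atTop (𝓝 0) := by
  have hlim := (h.mul (H.tendsto_integral_shift_mul t t)).sqrt
  rw [zero_mul, Real.sqrt_zero] at hlim
  refine squeeze_zero (fun n => integral_nonneg fun x => (shiftDensity_pos _ _ _).le)
    (fun n => Real.le_sqrt_of_sq_le ?_) hlim
  have hI : MemLp ((A n).indicator fun _ => (1 : ℝ)) 2 (μ n) :=
    memLp_indicator_const 2 (hA n) 1 (Or.inr (measure_ne_top _ _))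
  have hcs := sq_integral_abs_mul_le hI (H.memLp_shift t n)
  have e1 : ∫ x, |(A n).indicator (fun _ => (1 : ℝ)) x * shiftDensity v t (X n x)| ∂(μ n) =
      ∫ x in A n, shiftDensity v t (X n x) ∂(μ n) := by
    rw [← integral_indicator (hA n)]
    refine integral_congr_ae (ae_of_all _ fun x => ?_)
    by_cases hx : x ∈ A n
    · simp [hx, abs_of_pos (shiftDensity_pos v t (X n x))]
    · simp [hx]
  have e2 : ∫ x, (A n).indicator (fun _ => (1 : ℝ)) x ^ 2 ∂(μ n) = (μ n).real (A n) := by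
    rw [← integral_indicator_one (hA n)]
    refine integral_congr_ae (ae_of_all _ fun x => ?_)
    by_cases hx : x ∈ A n <;> simp [hx]
  rw [e1, e2] at hcs
  simp_rw [← sq]
  exact hcs

lemma eventually_setIntegral_le_of_posPart (H : GaussianShift μ X v) (hD : ∀ n, Measurable (D n))
    (hR : ∀ ε : ℝ, 0 < ε → Tendsto (fun n =>
      (μ n).real {x | ε ≤ |max (D n x) 0 - max (X n x) 0|}) atTop (𝓝 0))
    {t : ℝ} (ht : 0 < t) {c : ℕ → ℝ} (hc : Tendsto c atTop (𝓝 (t * v)))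
    {ε : ℝ} (hε : 0 < ε) :
    ∀ᶠ n in atTop, ∫ x in {x | D n x < c n}, shiftDensity v t (X n x) ∂(μ n) ≤ 1 / 2 + ε := by
  obtain ⟨δ, hδ, hs⟩ := H.exists_integral_abs_sub_le t (by positivity : 0 < ε / 4)
  set s := t + δ / 2 with hsdef
  have hst : |s - t| < δ := by
    rw [hsdef, add_sub_cancel_left, abs_of_pos (half_pos hδ)]; linarith
  have hs0 : 0 < s := by positivity
  have hv := H.pos
  -- The gap `sv - tv` equals `2r`: one `r` absorbs the moving threshold `c n`, the other the
  -- difference of the positive parts.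
  set r := δ * v / 4 with hr
  have hr0 : 0 < r := by positivity
  have hsv : s * v = t * v + 2 * r := by rw [hsdef, hr]; ring
  have hmR : ∀ n, MeasurableSet {x | r ≤ |max (D n x) 0 - max (X n x) 0|} := fun n =>
    measurableSet_le measurable_const
      (((hD n).max measurable_const).sub ((H.measurable n).max measurable_const)).abs
  filter_upwards [hs s hst,
    (H.tendsto_setIntegral_lt hs0).eventually
      (eventually_lt_nhds (by linarith : (1 : ℝ) / 2 < 1 / 2 + ε / 4)),
    (H.tendsto_setIntegral_zero t hmR (hR r hr0)).eventually
      (eventually_lt_nhds (by positivity : 0 < ε / 4)),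
    hc.eventually (eventually_lt_nhds (by linarith : t * v < t * v + r))] with n h1 h2 h3 h4
  have hi : Integrable (fun x => |shiftDensity v s (X n x) - shiftDensity v t (X n x)|) (μ n) :=
    ((H.integrable_shift s n).sub (H.integrable_shift t n)).abs
  have hi2 : Integrable (fun x => shiftDensity v s (X n x) +
      |shiftDensity v s (X n x) - shiftDensity v t (X n x)|) (μ n) :=
    (H.integrable_shift s n).add hi
  have hmX : MeasurableSet {x | X n x < s * v} := measurableSet_lt (H.measurable n) measurable_const
  have hW := H.integrable_shift t n
  have hsub : {x | D n x < c n} ⊆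
      {x | X n x < s * v} ∪ {x | r ≤ |max (D n x) 0 - max (X n x) 0|} := by
    intro x (hx : D n x < c n)
    by_cases hr : r ≤ |max (D n x) 0 - max (X n x) 0|
    · right; exact hr
    · left
      have h4' := (abs_lt.1 (not_le.1 hr)).1
      have h5 : max (D n x) 0 < t * v + r := max_lt (hx.trans h4) (by positivity)
      have h6 := le_max_left (X n x) 0
      show X n x < s * v
      linarith
  have hfirst : ∫ x in {x | X n x < s * v}, shiftDensity v t (X n x) ∂(μ n) ≤
      ∫ x in {x | X n x < s * v}, shiftDensity v s (X n x) ∂(μ n) + ε / 4 := by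
    calc ∫ x in {x | X n x < s * v}, shiftDensity v t (X n x) ∂(μ n)
        ≤ ∫ x in {x | X n x < s * v}, (shiftDensity v s (X n x) +
            |shiftDensity v s (X n x) - shiftDensity v t (X n x)|) ∂(μ n) := by
          refine setIntegral_mono hW.integrableOn hi2.integrableOn fun x => ?_
          simp only
          linarith [neg_le_abs (shiftDensity v s (X n x) - shiftDensity v t (X n x))]
      _ = _ := integral_add (H.integrable_shift s n).integrableOn hi.integrableOn
      _ ≤ _ := by
          gcongr
          exact (setIntegral_le_integral hi (ae_of_all _ fun x => abs_nonneg _)).trans h1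
  have hunion : ∫ x in {x | D n x < c n}, shiftDensity v t (X n x) ∂(μ n) ≤
      ∫ x in {x | X n x < s * v}, shiftDensity v t (X n x) ∂(μ n) +
        ∫ x in {x | r ≤ |max (D n x) 0 - max (X n x) 0|}, shiftDensity v t (X n x) ∂(μ n) := by
    have hmDc : MeasurableSet {x | D n x < c n} := measurableSet_lt (hD n) measurable_const
    rw [← integral_indicator hmDc, ← integral_indicator hmX, ← integral_indicator (hmR n),
      ← integral_add (hW.indicator hmX) (hW.indicator (hmR n))]
    refine integral_mono (hW.indicator hmDc)
      ((hW.indicator hmX).add (hW.indicator (hmR n))) fun x => ?_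
    have hpos := (shiftDensity_pos v t (X n x)).le
    have n1 := Set.indicator_nonneg (s := {x | X n x < s * v})
      (f := fun x => shiftDensity v t (X n x)) (fun x _ => (shiftDensity_pos v t (X n x)).le) x
    have n2 := Set.indicator_nonneg (s := {x | r ≤ |max (D n x) 0 - max (X n x) 0|})
      (f := fun x => shiftDensity v t (X n x)) (fun x _ => (shiftDensity_pos v t (X n x)).le) x
    by_cases hx : x ∈ {x | D n x < c n}
    · rw [Set.indicator_of_mem hx]
      rcases hsub hx with hx' | hx'
      · rw [Set.indicator_of_mem hx']
        exact le_add_of_nonneg_right n2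
      · rw [Set.indicator_of_mem hx' (f := fun x => shiftDensity v t (X n x))]
        exact le_add_of_nonneg_left n1
    · rw [Set.indicator_of_notMem hx]
      exact add_nonneg n1 n2
  linarith

end GaussianShift

end PositivePart

/-! ### Projection onto a convex cone -/

section Projection

variable {H : Type*} [NormedAddCommGroup H] [InnerProductSpace ℝ H]

lemma IsLinearSpace.isConvexCone {G : Set H} (hG : IsLinearSpace G) : IsConvexCone G := by
  obtain ⟨V, rfl⟩ := hG
  exact ⟨V.zero_mem, fun g₁ h₁ g₂ h₂ γ₁ γ₂ _ _ =>
    V.add_mem (V.smul_mem γ₁ h₁) (V.smul_mem γ₂ h₂)⟩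

/-- The projection `p` of `κ` onto a convex cone satisfies `κ - p ⊥ p`. -/
lemma IsProjection.inner_eq {G : Set H} (hG : IsConvexCone G) {κ p : H}
    (hp : IsProjection G κ p) (hp0 : p ≠ 0) : inner ℝ κ p = ‖p‖ ^ 2 := by
  have hb : 0 < ‖p‖ ^ 2 := by positivity
  have key : ∀ γ : ℝ, 0 ≤ γ →
      ‖p‖ ^ 2 - 2 * inner ℝ κ p ≤ γ ^ 2 * ‖p‖ ^ 2 - 2 * γ * inner ℝ κ p := by
    intro γ hγ
    have hmem : γ • p ∈ G := by
      have := hG.2 p hp.1 p hp.1 γ 0 hγ le_rfl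
      simpa using this
    have h1 : ‖κ - p‖ ^ 2 ≤ ‖κ - γ • p‖ ^ 2 := by
      gcongr; exact hp.2 _ hmem
    rw [norm_sub_sq_real, norm_sub_sq_real, inner_smul_right, norm_smul, mul_pow,
      Real.norm_eq_abs, sq_abs] at h1
    linarith
  set a := inner ℝ κ p
  set b := ‖p‖ ^ 2
  have ha : 0 ≤ a := by
    have := key 0 le_rfl
    norm_num at this
    linarith
  -- `γ = a/b` minimises the quadratic on the right; the inequality there becomes `(a - b)² ≤ 0`.
  have h2 := key (a / b) (by positivity)
  have e : (a / b) ^ 2 * b - 2 * (a / b) * a = -(a ^ 2 / b) := by field_simp; ring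
  rw [e] at h2
  have h3 : (a - b) ^ 2 ≤ 0 := by
    have h4 : (a - b) ^ 2 = b * (b - 2 * a + a ^ 2 / b) := by field_simp; ring
    rw [h4]
    exact mul_nonpos_of_nonneg_of_nonpos hb.le (by linarith)
  have h5 : a - b = 0 := pow_eq_zero_iff (two_ne_zero) |>.1 (le_antisymm h3 (sq_nonneg _))
  linarith

end Projection

/-! ### Remainders negligible in probability -/

section Negligible

variable {Ω : Type*} [MeasurableSpace Ω] {P : ProbabilityMeasure Ω}

lemma IsLittleOProb.of_abs_le_add {R R₁ R₂ : (n : ℕ) → (Fin n → Ω) → ℝ}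
    (h₁ : IsLittleOProb P R₁) (h₂ : IsLittleOProb P R₂)
    (h : ∀ n x, |R n x| ≤ |R₁ n x| + |R₂ n x|) : IsLittleOProb P R := by
  intro ε hε
  have hlim := (h₁ (ε / 2) (half_pos hε)).add (h₂ (ε / 2) (half_pos hε))
  rw [add_zero] at hlim
  refine squeeze_zero (fun n => measureReal_nonneg) (fun n => ?_) hlim
  refine (measureReal_mono ?_).trans (measureReal_union_le _ _)
  intro x (hx : ε ≤ |R n x|)
  by_contra hcon
  simp only [Set.mem_union, Set.mem_ofPred_eq, not_or, not_le] at hcon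
  linarith [h n x]

lemma IsLittleOProb.of_abs_le {R R₁ : (n : ℕ) → (Fin n → Ω) → ℝ} (h₁ : IsLittleOProb P R₁)
    (h : ∀ n x, |R n x| ≤ |R₁ n x|) : IsLittleOProb P R :=
  h₁.of_abs_le_add h₁ fun n x => (h n x).trans (le_add_of_nonneg_left (abs_nonneg _))

lemma IsLittleOProb.congr_ae {R R₁ : (n : ℕ) → (Fin n → Ω) → ℝ} (h₁ : IsLittleOProb P R₁)
    (h : ∀ n, R₁ n =ᵐ[iidLaw P n] R n) : IsLittleOProb P R := by
  intro ε hε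
  refine (h₁ ε hε).congr fun n => measureReal_congr ?_
  filter_upwards [h n] with x hx
  change (ε ≤ |R₁ n x|) = (ε ≤ |R n x|)
  rw [hx]

lemma normedSum_congr_ae {η₁ η₂ : Ω → ℝ} (h : η₁ =ᵐ[(P : Measure Ω)] η₂) (n : ℕ) :
    normedSum η₁ n =ᵐ[iidLaw P n] normedSum η₂ n := by
  have : ∀ i : Fin n, ∀ᵐ x ∂(iidLaw P n), η₁ (x i) = η₂ (x i) := fun i =>
    (measurePreserving_eval (fun _ : Fin n => (P : Measure Ω)) i).quasiMeasurePreserving.ae h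
  filter_upwards [ae_all_iff.2 this] with x hx
  simp only [normedSum, hx]

end Negligible

/-! ### One-sided bound along a single path -/

section OneDirection

variable {Ω : Type*} [MeasurableSpace Ω] {𝓜 : Set (ProbabilityMeasure Ω)}
  {P : ProbabilityMeasure Ω} {g : Lp ℝ 2 (P : Measure Ω)} {Q : ℝ → ProbabilityMeasure Ω}
  {T : ProbabilityMeasure Ω → ℝ} {S : (n : ℕ) → (Fin n → Ω) → ℝ}

lemma integral_sq_eq_norm_sq (g : Lp ℝ 2 (P : Measure Ω)) :
    ∫ x, g x ^ 2 ∂(P : Measure Ω) = ‖g‖ ^ 2 := by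
  rw [← real_inner_self_eq_norm_sq, L2.inner_def]
  refine integral_congr_ae (ae_of_all _ fun x => ?_)
  simp [sq]

lemma gaussianShift_localScore (h0 : ∫ x, g x ∂(P : Measure Ω) = 0) (hg : g ≠ 0) :
    GaussianShift (fun n => iidLaw P n) (fun n => localScore P g n) (‖g‖ ^ 2) := by
  have hm : Measurable g := (Lp.stronglyMeasurable g).measurable
  have h2 : MemLp g 2 (P : Measure Ω) := Lp.memLp g
  refine ⟨by positivity, measurable_localScore hm, fun t n => integrable_exp_localScore hm t n,
    fun t => ?_, ?_⟩
  · rw [← integral_sq_eq_norm_sq]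
    exact tendsto_integral_exp_localScore hm h2 h0 t
  · have := tendstoInDistribution_localScore hm h2 h0
    simp_rw [integral_sq_eq_norm_sq] at this
    exact this

/-- The local parameter of the estimator. -/
def localEstimator (P : ProbabilityMeasure Ω) (T : ProbabilityMeasure Ω → ℝ)
    (S : (n : ℕ) → (Fin n → Ω) → ℝ) (n : ℕ) (x : Fin n → Ω) : ℝ :=
  √(n : ℝ) * (S n x - T P)

/-- The local parameter of the functional along a path. -/
def localFunctional (P : ProbabilityMeasure Ω) (T : ProbabilityMeasure Ω → ℝ)
    (Q : ℝ → ProbabilityMeasure Ω) (t : ℝ) (n : ℕ) : ℝ :=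
  √(n : ℝ) * (T (Q (t / √(n : ℝ))) - T P)

lemma measurable_localEstimator (hS : ∀ n, Measurable (S n)) (n : ℕ) :
    Measurable (localEstimator P T S n) :=
  ((hS n).sub_const _).const_mul _

lemma tendsto_localFunctional {b : ℝ}
    (hT : (fun s : ℝ => T (Q s) - T P - s * b) =o[𝓝[>] 0] (fun s : ℝ => s)) {t : ℝ} (ht : 0 < t) :
    Tendsto (localFunctional P T Q t) atTop (𝓝 (t * b)) := by
  have h1 := (hT.tendsto_div_nhds_zero.comp (tendsto_div_sqrt_nhdsGT ht)).const_mul t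
  have h2 := h1.add_const (t * b)
  rw [mul_zero, zero_add] at h2
  refine h2.congr' ?_
  filter_upwards [eventually_gt_atTop 0] with n hn
  have hn' : (0 : ℝ) < n := by exact_mod_cast hn
  have hs : 0 < √(n : ℝ) := Real.sqrt_pos.2 hn'
  simp only [Function.comp, localFunctional]
  field_simp
  ring

lemma oneSidedProb_eq {c : ℝ} {n : ℕ} (hn : 0 < n) :
    oneSidedProb P T S c n = (iidLaw P n).real {x | localEstimator P T S n x < c} := by
  have hn' : (0 : ℝ) < n := by exact_mod_cast hn
  have hs : 0 < √(n : ℝ) := Real.sqrt_pos.2 hn'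
  unfold oneSidedProb localEstimator
  congr 1
  ext x
  simp only [Set.mem_ofPred_eq, gt_iff_lt]
  rw [← lt_div_iff₀' hs, sub_lt_comm]

lemma limsup_oneSidedProb_le_iff {c a : ℝ} :
    limsup (oneSidedProb P T S c) atTop ≤ a ↔
      ∀ ε : ℝ, 0 < ε → ∀ᶠ n in atTop, oneSidedProb P T S c n ≤ a + ε :=
  limsup_le_iff_forall_eventually_le (fun _ => measureReal_nonneg) (fun _ => measureReal_le_one)

lemma limsup_twoSidedProb_le_iff {c' c'' a : ℝ} :
    limsup (twoSidedProb P T S c' c'') atTop ≤ a ↔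
      ∀ ε : ℝ, 0 < ε → ∀ᶠ n in atTop, twoSidedProb P T S c' c'' n ≤ a + ε :=
  limsup_le_iff_forall_eventually_le (fun _ => measureReal_nonneg) (fun _ => measureReal_le_one)

/-- Local asymptotic normality moves the median condition from the alternatives to `P^n`, where it
becomes a condition on integrals of the Gaussian likelihood ratio. -/
lemma asympMedianGE_iff (hQ : IsTangentPath 𝓜 P g Q) (hS : ∀ n, Measurable (S n)) :
    AsympMedianGE T Q S ↔ ∀ t, 0 < t → ∀ ε : ℝ, 0 < ε → ∀ᶠ n in atTop,
      ∫ x in {x | localEstimator P T S n x < localFunctional P T Q t n},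
        shiftDensity (‖g‖ ^ 2) t (localScore P g n x) ∂(iidLaw P n) ≤ 1 / 2 + ε := by
  refine forall₂_congr fun t ht => ?_
  rw [limsup_le_iff_forall_eventually_le (fun n => measureReal_nonneg)
    (fun n => measureReal_le_one)]
  have hA : ∀ n : ℕ, MeasurableSet {x | S n x < T (Q (t / √(n : ℝ)))} := fun n =>
    measurableSet_lt (hS n) measurable_const
  have hlan := hQ.tendsto_iidLaw_sub ht hA
  rw [integral_sq_eq_norm_sq] at hlan
  have hset : ∀ᶠ n : ℕ in atTop, {x | S n x < T (Q (t / √(n : ℝ)))} =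
      {x | localEstimator P T S n x < localFunctional P T Q t n} := by
    filter_upwards [eventually_gt_atTop 0] with n hn
    have hn' : (0 : ℝ) < n := by exact_mod_cast hn
    have hs : 0 < √(n : ℝ) := Real.sqrt_pos.2 hn'
    ext x
    simp only [Set.mem_ofPred_eq, localEstimator, localFunctional]
    rw [mul_lt_mul_iff_right₀ hs, sub_lt_sub_iff_right]
  constructor
  · intro h ε hε
    filter_upwards [h (ε / 2) (half_pos hε), hset,
      hlan.eventually (eventually_gt_nhds (by linarith : -(ε / 2) < 0))] with n h1 h2 h3
    rw [h2] at h1 h3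
    simp only [shiftDensity]
    linarith
  · intro h ε hε
    filter_upwards [h (ε / 2) (half_pos hε), hset,
      hlan.eventually (eventually_lt_nhds (half_pos hε))] with n h1 h2 h3
    rw [h2] at h3 ⊢
    simp only [shiftDensity] at h1
    linarith

/-- Truncation changes the normed sum by a negligible amount, and taking positive parts is
1-Lipschitz. -/
lemma isLittleOProb_posPart_iff (h0 : ∫ x, g x ∂(P : Measure Ω) = 0) :
    IsLittleOProb P (fun n x => √(n : ℝ) * max (S n x - T P) 0 - max (normedSum g n x) 0) ↔
      IsLittleOProb P
        (fun n x => max (localEstimator P T S n x) 0 - max (localScore P g n x) 0) := by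
  have hm : Measurable g := (Lp.stronglyMeasurable g).measurable
  have hd := isLittleOProb_localScore_sub hm (Lp.memLp g) h0
  have e : ∀ (n : ℕ) x, √(n : ℝ) * max (S n x - T P) 0 = max (localEstimator P T S n x) 0 :=
    fun n x => by
      rw [mul_max_of_nonneg _ _ (Real.sqrt_nonneg _), mul_zero]; rfl
  simp_rw [e]
  refine ⟨fun h => h.of_abs_le_add hd fun n x => ?_, fun h => h.of_abs_le_add hd fun n x => ?_⟩
  · have h1 := abs_max_sub_max_le_abs (localScore P g n x) (normedSum g n x) 0
    have h2 := abs_sub_le (max (localEstimator P T S n x) 0) (max (normedSum g n x) 0)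
      (max (localScore P g n x) 0)
    rw [abs_sub_comm (max (normedSum g n x) 0)] at h2
    linarith
  · have h1 := abs_max_sub_max_le_abs (localScore P g n x) (normedSum g n x) 0
    have h2 := abs_sub_le (max (localEstimator P T S n x) 0) (max (localScore P g n x) 0)
      (max (normedSum g n x) 0)
    linarith

/-- The asymptotic bound for one-sided concentration, along a path with tangent `g` in the
direction of which the functional has derivative `‖g‖²`. -/
theorem limsup_oneSidedProb_le (hQ : IsTangentPath 𝓜 P g Q) (hg : g ≠ 0)
    (hT : (fun s : ℝ => T (Q s) - T P - s * ‖g‖ ^ 2) =o[𝓝[>] 0] (fun s : ℝ => s))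
    (hS : ∀ n, Measurable (S n)) (hmed : AsympMedianGE T Q S) {c : ℝ} (hc : 0 < c) :
    limsup (oneSidedProb P T S c) atTop ≤ Phi (c / ‖g‖) := by
  have H := gaussianShift_localScore hQ.centered hg
  rw [limsup_oneSidedProb_le_iff]
  intro ε hε
  have h1 := fun t ht ε hε => H.eventually_setIntegral_lt_le
    (fun t ht => tendsto_localFunctional hT ht) ((asympMedianGE_iff hQ hS).1 hmed)
    (t := t) ht (ε := ε) hε
  have h2 := H.eventually_real_lt_le h1 (measurable_localEstimator hS) hc hε
  rw [Real.sqrt_sq (norm_nonneg _)] at h2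
  filter_upwards [h2, eventually_gt_atTop 0] with n hn hn0
  rwa [oneSidedProb_eq hn0]

/-- Characterization of the median unbiased estimators attaining the one-sided bound. -/
theorem attains_oneSided_iff (hQ : IsTangentPath 𝓜 P g Q) (hg : g ≠ 0)
    (hT : (fun s : ℝ => T (Q s) - T P - s * ‖g‖ ^ 2) =o[𝓝[>] 0] (fun s : ℝ => s))
    (hS : ∀ n, Measurable (S n)) :
    (AsympMedianGE T Q S ∧ ∀ c : ℝ, 0 < c →
      Tendsto (oneSidedProb P T S c) atTop (𝓝 (Phi (c / ‖g‖)))) ↔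
    IsLittleOProb P
      (fun n x => √(n : ℝ) * max (S n x - T P) 0 - max (normedSum g n x) 0) := by
  have H := gaussianShift_localScore hQ.centered hg
  have hsq : √(‖g‖ ^ 2) = ‖g‖ := Real.sqrt_sq (norm_nonneg _)
  have hone : ∀ c : ℝ, Tendsto (oneSidedProb P T S c) atTop (𝓝 (Phi (c / ‖g‖))) ↔
      Tendsto (fun n => (iidLaw P n).real {x | localEstimator P T S n x < c}) atTop
        (𝓝 (Phi (c / √(‖g‖ ^ 2)))) := fun c => by
    rw [hsq]
    refine tendsto_congr' ?_
    filter_upwards [eventually_gt_atTop 0] with n hn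
    exact oneSidedProb_eq hn
  rw [isLittleOProb_posPart_iff hQ.centered, asympMedianGE_iff hQ hS]
  constructor
  · rintro ⟨hmed, hatt⟩ ε hε
    exact H.tendsto_real_posPart_sub_of_attains
      (fun t ht ε hε => H.eventually_setIntegral_lt_le
        (fun t ht => tendsto_localFunctional hT ht) hmed ht hε)
      (measurable_localEstimator hS) (fun c hc => (hone c).1 (hatt c hc)) hε
  · intro hR
    exact ⟨fun t ht ε hε => H.eventually_setIntegral_le_of_posPart (measurable_localEstimator hS)
        hR ht (tendsto_localFunctional hT ht) hε,
      fun c hc => (hone c).2 (H.tendsto_real_lt_of_posPart hR hc)⟩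

end OneDirection

/-! ### Two-sided bound by reflection -/

section TwoDirections

variable {Ω : Type*} [MeasurableSpace Ω] {𝓜 : Set (ProbabilityMeasure Ω)}
  {P : ProbabilityMeasure Ω} {g : Lp ℝ 2 (P : Measure Ω)} {Q Q' : ℝ → ProbabilityMeasure Ω}
  {T : ProbabilityMeasure Ω → ℝ} {S : (n : ℕ) → (Fin n → Ω) → ℝ}

lemma asympMedianLE_iff_neg :
    AsympMedianLE T Q S ↔ AsympMedianGE (fun R => -T R) Q (fun n x => -S n x) := by
  simp only [AsympMedianLE, AsympMedianGE, gt_iff_lt, neg_lt_neg_iff]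

/-- Inclusion–exclusion: since `c'` and `c''` are positive, the two one-sided events together cover
the whole space. -/
lemma twoSidedProb_eq (hS : ∀ n, Measurable (S n)) {c' c'' : ℝ} (hc' : 0 < c') (hc'' : 0 < c'')
    {n : ℕ} (hn : 0 < n) :
    twoSidedProb P T S c' c'' n = oneSidedProb P T S c'' n +
      oneSidedProb P (fun R => -T R) (fun n x => -S n x) c' n - 1 := by
  have hn' : (0 : ℝ) < n := by exact_mod_cast hn
  have hs : 0 < √(n : ℝ) := Real.sqrt_pos.2 hn'
  have h1 : 0 < c' / √(n : ℝ) := by positivity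
  have h2 : 0 < c'' / √(n : ℝ) := by positivity
  have hB : {x | -T P > -S n x - c' / √(n : ℝ)} = {x | T P < S n x + c' / √(n : ℝ)} := by
    ext x
    simp only [Set.mem_ofPred_eq]
    constructor <;> intro h <;> linarith
  have mB : MeasurableSet {x | T P < S n x + c' / √(n : ℝ)} :=
    measurableSet_lt measurable_const ((hS n).add_const _)
  have hunion : {x | T P > S n x - c'' / √(n : ℝ)} ∪ {x | T P < S n x + c' / √(n : ℝ)} =
      Set.univ := by
    ext x
    simp only [Set.mem_union, Set.mem_ofPred_eq, Set.mem_univ, iff_true]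
    by_contra hcon
    rw [not_or, not_lt, not_lt] at hcon
    linarith [hcon.1, hcon.2]
  have h := measureReal_union_add_inter (μ := iidLaw P n)
    (s := {x | T P > S n x - c'' / √(n : ℝ)}) mB
  rw [hunion, probReal_univ] at h
  unfold twoSidedProb oneSidedProb
  rw [hB]
  have e : {x | S n x - c'' / √(n : ℝ) < T P ∧ T P < S n x + c' / √(n : ℝ)} =
    {x | T P > S n x - c'' / √(n : ℝ)} ∩ {x | T P < S n x + c' / √(n : ℝ)} := rfl
  rw [e]
  linarith

/-- A real number is `y₊ - (-y)₊`. The class `-g` is represented by the pointwise negative only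
almost everywhere, hence the passage through `congr_ae`. -/
lemma isLittleOProb_iff_posPart :
    IsLittleOProb P (fun n x => √(n : ℝ) * (S n x - T P) - normedSum g n x) ↔
      IsLittleOProb P (fun n x => √(n : ℝ) * max (S n x - T P) 0 - max (normedSum g n x) 0) ∧
      IsLittleOProb P (fun n x => √(n : ℝ) * max (-S n x - -T P) 0 -
        max (normedSum (-g : Lp ℝ 2 (P : Measure Ω)) n x) 0) := by
  have hneg : ∀ n, normedSum (-g : Lp ℝ 2 (P : Measure Ω)) n =ᵐ[iidLaw P n]
      fun x => -normedSum g n x := fun n => by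
    filter_upwards [normedSum_congr_ae (Lp.coeFn_neg g) n] with x hx
    rw [hx]
    simp [normedSum]
  have hpos : ∀ n (y : ℝ), √(n : ℝ) * max y 0 = max (√(n : ℝ) * y) 0 := fun n y => by
    rw [mul_max_of_nonneg _ _ (Real.sqrt_nonneg _), mul_zero]
  constructor
  · intro h
    refine ⟨h.of_abs_le fun n x => ?_, ?_⟩
    · rw [hpos]
      exact abs_max_sub_max_le_abs _ _ _
    · refine (h.of_abs_le (R := fun n x => √(n : ℝ) * max (-S n x - -T P) 0 -
        max (-normedSum g n x) 0) fun n x => ?_).congr_ae fun n => ?_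
      · rw [hpos]
        refine (abs_max_sub_max_le_abs _ _ _).trans (le_of_eq ?_)
        rw [← abs_neg]
        congr 1; ring
      · filter_upwards [hneg n] with x hx
        simp only [hx]
  · rintro ⟨h1, h2⟩
    have h2' : IsLittleOProb P (fun n x => √(n : ℝ) * max (-S n x - -T P) 0 -
        max (-normedSum g n x) 0) := h2.congr_ae fun n => by
      filter_upwards [hneg n] with x hx
      simp only [hx]
    refine h1.of_abs_le_add h2' fun n x => ?_
    refine le_trans (le_of_eq ?_) (abs_sub _ _)
    congr 1
    have e : ∀ y : ℝ, max y 0 - max (-y) 0 = y := fun y => by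
      rcases le_total y 0 with hy | hy
      · rw [max_eq_right hy, max_eq_left (by linarith)]; ring
      · rw [max_eq_left hy, max_eq_right (by linarith)]; ring
    have e1 := e (S n x - T P)
    have e2 := e (normedSum g n x)
    have e3 : -S n x - -T P = -(S n x - T P) := by ring
    rw [e3]
    linear_combination (-√(n : ℝ)) * e1 + e2

/-- The asymptotic bound for two-sided concentration. -/
theorem limsup_twoSidedProb_le (hQ : IsTangentPath 𝓜 P g Q) (hQ' : IsTangentPath 𝓜 P (-g) Q')
    (hg : g ≠ 0) (hT : (fun s : ℝ => T (Q s) - T P - s * ‖g‖ ^ 2) =o[𝓝[>] 0] (fun s : ℝ => s))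
    (hT' : (fun s : ℝ => -T (Q' s) - -T P - s * ‖-g‖ ^ 2) =o[𝓝[>] 0] (fun s : ℝ => s))
    (hS : ∀ n, Measurable (S n)) (hmed : AsympMedianGE T Q S) (hmed' : AsympMedianLE T Q' S)
    {c' c'' : ℝ} (hc' : 0 < c') (hc'' : 0 < c'') :
    limsup (twoSidedProb P T S c' c'') atTop ≤ Phi (c'' / ‖g‖) - Phi (-c' / ‖g‖) := by
  have h1 := limsup_oneSidedProb_le hQ hg hT hS hmed hc''
  have h2 := limsup_oneSidedProb_le (T := fun R => -T R) (S := fun n x => -S n x) hQ'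
    (neg_ne_zero.2 hg) hT' (fun n => (hS n).neg) (asympMedianLE_iff_neg.1 hmed') hc'
  rw [norm_neg] at h2
  rw [limsup_oneSidedProb_le_iff] at h1 h2
  rw [limsup_twoSidedProb_le_iff]
  intro ε hε
  filter_upwards [h1 (ε / 2) (half_pos hε), h2 (ε / 2) (half_pos hε), eventually_gt_atTop 0]
    with n h3 h4 hn
  rw [twoSidedProb_eq hS hc' hc'' hn, neg_div, Phi_neg]
  linarith

/-- Characterization of the median unbiased estimators attaining the two-sided bound. -/
theorem attains_twoSided_iff (hQ : IsTangentPath 𝓜 P g Q) (hQ' : IsTangentPath 𝓜 P (-g) Q')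
    (hg : g ≠ 0) (hT : (fun s : ℝ => T (Q s) - T P - s * ‖g‖ ^ 2) =o[𝓝[>] 0] (fun s : ℝ => s))
    (hT' : (fun s : ℝ => -T (Q' s) - -T P - s * ‖-g‖ ^ 2) =o[𝓝[>] 0] (fun s : ℝ => s))
    (hS : ∀ n, Measurable (S n)) :
    (AsympMedianGE T Q S ∧ AsympMedianLE T Q' S ∧ ∀ c' c'' : ℝ, 0 < c' → 0 < c'' →
      Tendsto (twoSidedProb P T S c' c'') atTop
        (𝓝 (Phi (c'' / ‖g‖) - Phi (-c' / ‖g‖)))) ↔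
    IsLittleOProb P (fun n x => √(n : ℝ) * (S n x - T P) - normedSum g n x) := by
  have hg' : -g ≠ 0 := neg_ne_zero.2 hg
  have hS' : ∀ n, Measurable fun x => -S n x := fun n => (hS n).neg
  rw [isLittleOProb_iff_posPart, ← attains_oneSided_iff hQ hg hT hS,
    ← attains_oneSided_iff (T := fun R => -T R) (S := fun n x => -S n x) hQ' hg' hT' hS', ← asympMedianLE_iff_neg, norm_neg]
  constructor
  · rintro ⟨hmed, hmed', hatt⟩
    have b1 := fun c hc => limsup_oneSidedProb_le hQ hg hT hS hmed (c := c) hc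
    have b2 := fun c hc => limsup_oneSidedProb_le hQ' hg' hT' hS'
      (asympMedianLE_iff_neg.1 hmed') (c := c) hc
    simp only [limsup_oneSidedProb_le_iff] at b1
    simp only [norm_neg, limsup_oneSidedProb_le_iff] at b2
    refine ⟨⟨hmed, fun c hc => tendsto_of_forall_eventually (b1 c hc) fun ε hε => ?_⟩,
      hmed', fun c hc => tendsto_of_forall_eventually (b2 c hc) fun ε hε => ?_⟩
    -- The case `c' = c'' = c` is enough: the sum of the one-sided probabilities tends to the sum of
    -- their bounds, and the other summand cannot asymptotically exceed its own bound.
    · have h := hatt c c hc hc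
      rw [neg_div, Phi_neg] at h
      filter_upwards [h.eventually (eventually_gt_nhds (sub_lt_self _ (half_pos hε))),
        b2 c hc (ε / 2) (half_pos hε), eventually_gt_atTop 0] with n h1 h2 hn
      rw [twoSidedProb_eq hS hc hc hn] at h1
      linarith
    · have h := hatt c c hc hc
      rw [neg_div, Phi_neg] at h
      filter_upwards [h.eventually (eventually_gt_nhds (sub_lt_self _ (half_pos hε))),
        b1 c hc (ε / 2) (half_pos hε), eventually_gt_atTop 0] with n h1 h2 hn
      rw [twoSidedProb_eq hS hc hc hn] at h1
      linarith
  · rintro ⟨⟨hmed, hatt⟩, hmed', hatt'⟩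
    refine ⟨hmed, hmed', fun c' c'' hc' hc'' => ?_⟩
    have h := ((hatt c'' hc'').add (hatt' c' hc')).sub_const 1
    rw [neg_div, Phi_neg]
    have e : Phi (c'' / ‖g‖) - (1 - Phi (c' / ‖g‖)) = Phi (c'' / ‖g‖) + Phi (c' / ‖g‖) - 1 := by
      ring
    rw [e]
    refine h.congr' ?_
    filter_upwards [eventually_gt_atTop 0] with n hn
    exact (twoSidedProb_eq hS hc' hc'' hn).symm

end TwoDirections

end TangentConeInference

end

theorem mainTheorem10 {Ω : Type*} [MeasurableSpace Ω]
    (𝓜 : Set (ProbabilityMeasure Ω)) (P : ProbabilityMeasure Ω) (hP : P ∈ 𝓜)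
    (path : Lp ℝ 2 (P : Measure Ω) → ℝ → ProbabilityMeasure Ω)
    (hpath : ∀ g ∈ TangentConeInference.tangentSet 𝓜 P,
      TangentConeInference.IsTangentPath 𝓜 P g (path g))
    (T : ProbabilityMeasure Ω → ℝ) (κ : Lp ℝ 2 (P : Measure Ω))
    (hT : TangentConeInference.HasGradient 𝓜 P path T κ)
    (hclosed : IsClosed (TangentConeInference.tangentSet 𝓜 P)) :
    -- a) the tangent set is a (closed) convex cone
    (TangentConeInference.IsConvexCone (TangentConeInference.tangentSet 𝓜 P) →
      ∀ κhat : Lp ℝ 2 (P : Measure Ω),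
        TangentConeInference.IsProjection (TangentConeInference.tangentSet 𝓜 P) κ κhat →
        κhat ≠ 0 →
        ∀ S : (n : ℕ) → (Fin n → Ω) → ℝ, (∀ n, Measurable (S n)) →
          (TangentConeInference.AsympMedianGE T (path κhat) S →
            ∀ c : ℝ, 0 < c →
              limsup (TangentConeInference.oneSidedProb P T S c) atTop ≤
                TangentConeInference.Phi (c / ‖κhat‖)) ∧
          ((TangentConeInference.AsympMedianGE T (path κhat) S ∧
            ∀ c : ℝ, 0 < c →
              Tendsto (TangentConeInference.oneSidedProb P T S c) atTop
                (𝓝 (TangentConeInference.Phi (c / ‖κhat‖)))) ↔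
            TangentConeInference.IsLittleOProb P (fun n x =>
              √(n : ℝ) * max (S n x - T P) 0 -
                max (TangentConeInference.normedSum κhat n x) 0))) ∧
    -- b) the tangent set is a (closed) linear space
    (TangentConeInference.IsLinearSpace (TangentConeInference.tangentSet 𝓜 P) →
      ∀ κbar : Lp ℝ 2 (P : Measure Ω),
        TangentConeInference.IsProjection (TangentConeInference.tangentSet 𝓜 P) κ κbar →
        κbar ≠ 0 →
        ∀ S : (n : ℕ) → (Fin n → Ω) → ℝ, (∀ n, Measurable (S n)) →
          (TangentConeInference.AsympMedianGE T (path κbar) S →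
            TangentConeInference.AsympMedianLE T (path (-κbar)) S →
            ∀ c' c'' : ℝ, 0 < c' → 0 < c'' →
              limsup (TangentConeInference.twoSidedProb P T S c' c'') atTop ≤
                TangentConeInference.Phi (c'' / ‖κbar‖) -
                  TangentConeInference.Phi (-c' / ‖κbar‖)) ∧
          ((TangentConeInference.AsympMedianGE T (path κbar) S ∧
            TangentConeInference.AsympMedianLE T (path (-κbar)) S ∧
            ∀ c' c'' : ℝ, 0 < c' → 0 < c'' →
              Tendsto (TangentConeInference.twoSidedProb P T S c' c'') atTop
                (𝓝 (TangentConeInference.Phi (c'' / ‖κbar‖) -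
                  TangentConeInference.Phi (-c' / ‖κbar‖)))) ↔
            TangentConeInference.IsLittleOProb P (fun n x =>
              √(n : ℝ) * (S n x - T P) - TangentConeInference.normedSum κbar n x))) := by
  -- The gradient enters only through `⟨κ, g⟩`, which for the projection is `‖g‖²`.
  have hdir : ∀ g ∈ TangentConeInference.tangentSet 𝓜 P, inner ℝ κ g = ‖g‖ ^ 2 →
      (fun s : ℝ => T (path g s) - T P - s * ‖g‖ ^ 2) =o[𝓝[>] 0] (fun s : ℝ => s) := by
    intro g hg hin
    rw [← hin]
    exact hT g hg
  refine ⟨fun hcone κhat hproj h0 S hS => ?_, fun hlin κbar hproj h0 S hS => ?_⟩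
  · have hQ := hpath κhat hproj.1
    have hTd := hdir κhat hproj.1 (hproj.inner_eq hcone h0)
    exact ⟨fun hmed c hc => TangentConeInference.limsup_oneSidedProb_le hQ h0 hTd hS hmed hc,
      TangentConeInference.attains_oneSided_iff hQ h0 hTd hS⟩
  · have hneg : -κbar ∈ TangentConeInference.tangentSet 𝓜 P := by
      obtain ⟨V, hV⟩ := hlin
      rw [← hV]
      exact V.neg_mem (by rw [← SetLike.mem_coe, hV]; exact hproj.1)
    have hin := hproj.inner_eq hlin.isConvexCone h0
    have hQ := hpath κbar hproj.1
    have hQ' := hpath (-κbar) hneg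
    have hTd := hdir κbar hproj.1 hin
    -- The two signs cancel: `-T` has derivative `‖κbar‖²` along `-κbar`, so the reflected problem
    -- has the same form.
    have hTd' : (fun s : ℝ => -T (path (-κbar) s) - -T P - s * ‖-κbar‖ ^ 2) =o[𝓝[>] 0]
        (fun s : ℝ => s) := by
      refine (hT (-κbar) hneg).neg_left.congr_left fun s => ?_
      rw [inner_neg_right, hin, norm_neg]
      ring
    exact ⟨fun hmed hmed' c' c'' hc' hc'' => TangentConeInference.limsup_twoSidedProb_le
        hQ hQ' h0 hTd hTd' hS hmed hmed' hc' hc'',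
      TangentConeInference.attains_twoSided_iff hQ hQ' h0 hTd hTd' hS⟩
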